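/- Let $\Gamma$ be a connected, locally finite graph of infinite rank, i.e. a connected one-dimensional CW complex, with loops and multiple edges allowed, in which every vertex is incident to only finitely many edges, and whose fundamental group (a free group) has infinite rank. Let $\mathrm{Map}(\Gamma)$ be the group of proper homotopy classes of proper homotopy equivalences $\Gamma\to\Gamma$, and let the pure mapping class group $\mathrm{PMap}(\Gamma)\le \mathrm{Map}(\Gamma)$ be the kernel of its action on the space of ends $E(\Gamma)=\varprojlim_{K\subset\Gamma\text{ compact}}\pi_0(\Gamma\setminus K)$. Then $\mathrm{PMap}(\Gamma)$ contains a subgroup isomorphic to the Grigorchuk group, i.e. to the group $\langle a,b,c,d\rangle$ of automorphisms of the infinite rooted binary tree, where $a$ swaps the two subtrees at the root and $b=(a,c)$, $c=(a,d)$, $d=(1,b)$ (each pair giving the actions on the two subtrees at the root). -/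

import Mathlib

open Topology TopologicalSpace unitInterval

noncomputable section

/-! ### Proper maps and proper homotopies -/

section ProperHomotopy

variable {X Y Z : Type*} [TopologicalSpace X] [TopologicalSpace Y] [TopologicalSpace Z]

/-- Continuous proper maps. (`IsProperMap` is Mathlib's notion; when the target is Hausdorff and
locally compact it says that the preimage of every compact set is compact.) -/
def ProperMap (X Y : Type*) [TopologicalSpace X] [TopologicalSpace Y] : Type _ :=
  {f : C(X, Y) // IsProperMap f}

/-- Two proper maps are properly homotopic if there is a homotopy `I × X → Y` between them which
is itself a proper map. -/
def ProperHomotopic (f g : ProperMap X Y) : Prop :=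
  ∃ H : ContinuousMap.Homotopy f.1 g.1, IsProperMap H

/-- The identity, as a proper map. -/
def ProperMap.id (X : Type*) [TopologicalSpace X] : ProperMap X X :=
  ⟨ContinuousMap.id X, isProperMap_id⟩

/-- Composition of proper maps. -/
def ProperMap.comp (g : ProperMap Y Z) (f : ProperMap X Y) : ProperMap X Z :=
  ⟨g.1.comp f.1, g.2.comp f.2⟩

theorem ProperHomotopic.refl (f : ProperMap X Y) : ProperHomotopic f f :=
  ⟨ContinuousMap.Homotopy.refl f.1,
    f.2.comp (isProperMap_snd_of_compactSpace : IsProperMap (Prod.snd : I × X → X))⟩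

theorem ProperHomotopic.symm {f g : ProperMap X Y} (h : ProperHomotopic f g) :
    ProperHomotopic g f := by
  obtain ⟨H, hH⟩ := h
  exact ⟨H.symm, hH.comp (unitInterval.symmHomeomorph.isProperMap.prodMap isProperMap_id)⟩

theorem ProperHomotopic.trans {f g h : ProperMap X Y} (h₁ : ProperHomotopic f g)
    (h₂ : ProperHomotopic g h) : ProperHomotopic f h := by
  obtain ⟨F, hF⟩ := h₁
  obtain ⟨G, hG⟩ := h₂
  refine ⟨F.trans G, ?_⟩
  let a : I → I := fun t => ⟨t / 2, by constructor <;> linarith [t.2.1, t.2.2]⟩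
  let b : I → I := fun t => ⟨(t + 1) / 2, by constructor <;> linarith [t.2.1, t.2.2]⟩
  have ha : Continuous a := by fun_prop
  have hb : Continuous b := by fun_prop
  have hFa : ∀ t x, (F.trans G) (a t, x) = F (t, x) := by
    intro t x
    have ht : ((a t : I) : ℝ) ≤ 1 / 2 := by
      change (t : ℝ) / 2 ≤ 1 / 2
      linarith [t.2.2]
    rw [ContinuousMap.Homotopy.trans_apply, dif_pos ht]
    congr 2
    apply Subtype.ext
    change 2 * ((t : ℝ) / 2) = t
    ring
  have hGb : ∀ t x, (F.trans G) (b t, x) = G (t, x) := by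
    intro t x
    by_cases ht : ((b t : I) : ℝ) ≤ 1 / 2
    · have h0 : t = 0 := by
        apply Subtype.ext
        change ((t : ℝ) + 1) / 2 ≤ 1 / 2 at ht
        change (t : ℝ) = 0
        linarith [t.2.1]
      rw [ContinuousMap.Homotopy.trans_apply, dif_pos ht]
      subst h0
      rw [G.apply_zero, ← F.apply_one]
      congr 2
      apply Subtype.ext
      change 2 * (((0 : I) + 1 : ℝ) / 2) = 1
      simp
    · rw [ContinuousMap.Homotopy.trans_apply, dif_neg ht]
      congr 2
      apply Subtype.ext
      change 2 * (((t : ℝ) + 1) / 2) - 1 = t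
      ring
  have hcov : ∀ t : I, (∃ s, a s = t) ∨ ∃ s, b s = t := by
    intro t
    rcases le_total (t : ℝ) (1 / 2) with ht | ht
    · refine Or.inl ⟨⟨2 * t, by constructor <;> linarith [t.2.1]⟩, Subtype.ext ?_⟩
      change 2 * (t : ℝ) / 2 = t
      ring
    · refine Or.inr ⟨⟨2 * t - 1, by constructor <;> linarith [t.2.2]⟩, Subtype.ext ?_⟩
      change (2 * (t : ℝ) - 1 + 1) / 2 = t
      ring
  have hcov' : ∀ p : I × X, (∃ q : I × X, (a q.1, q.2) = p) ∨ ∃ q : I × X, (b q.1, q.2) = p := by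
    rintro ⟨t, x⟩
    rcases hcov t with ⟨s, rfl⟩ | ⟨s, rfl⟩
    · exact Or.inl ⟨(s, x), rfl⟩
    · exact Or.inr ⟨(s, x), rfl⟩
  have ha' : Continuous fun q : I × X => (a q.1, q.2) := by fun_prop
  have hb' : Continuous fun q : I × X => (b q.1, q.2) := by fun_prop
  rw [isProperMap_iff_isClosedMap_and_compact_fibers]
  refine ⟨(F.trans G).continuous, fun C hC => ?_, fun y => ?_⟩
  · have : (F.trans G) '' C = F '' ((fun q : I × X => (a q.1, q.2)) ⁻¹' C) ∪
        G '' ((fun q : I × X => (b q.1, q.2)) ⁻¹' C) := by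
      ext y
      constructor
      · rintro ⟨p, hp, rfl⟩
        rcases hcov' p with ⟨q, rfl⟩ | ⟨q, rfl⟩
        · exact Or.inl ⟨q, hp, (hFa _ _).symm⟩
        · exact Or.inr ⟨q, hp, (hGb _ _).symm⟩
      · rintro (⟨q, hq, rfl⟩ | ⟨q, hq, rfl⟩)
        · exact ⟨_, hq, hFa _ _⟩
        · exact ⟨_, hq, hGb _ _⟩
    rw [this]
    exact (hF.isClosedMap _ (hC.preimage ha')).union (hG.isClosedMap _ (hC.preimage hb'))
  · have : (F.trans G) ⁻¹' {y} = (fun q : I × X => (a q.1, q.2)) '' (F ⁻¹' {y}) ∪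
        (fun q : I × X => (b q.1, q.2)) '' (G ⁻¹' {y}) := by
      ext p
      constructor
      · intro hp
        rcases hcov' p with ⟨q, rfl⟩ | ⟨q, rfl⟩
        · exact Or.inl ⟨q, (hFa _ _).symm.trans hp, rfl⟩
        · exact Or.inr ⟨q, (hGb _ _).symm.trans hp, rfl⟩
      · rintro (⟨q, hq, rfl⟩ | ⟨q, hq, rfl⟩)
        · exact (hFa _ _).trans hq
        · exact (hGb _ _).trans hq
    rw [this]
    exact ((hF.isCompact_preimage isCompact_singleton).image ha').union
      ((hG.isCompact_preimage isCompact_singleton).image hb')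

theorem ProperHomotopic.comp {g₀ g₁ : ProperMap Y Z} {f₀ f₁ : ProperMap X Y}
    (hg : ProperHomotopic g₀ g₁) (hf : ProperHomotopic f₀ f₁) :
    ProperHomotopic (g₀.comp f₀) (g₁.comp f₁) := by
  obtain ⟨G, hG⟩ := hg
  obtain ⟨F, hF⟩ := hf
  have h₁ : ProperHomotopic (g₀.comp f₀) (g₀.comp f₁) :=
    ⟨{ toContinuousMap := g₀.1.comp F.toContinuousMap
       map_zero_left := fun x => congrArg g₀.1 (F.apply_zero x)
       map_one_left := fun x => congrArg g₀.1 (F.apply_one x) }, g₀.2.comp hF⟩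
  have h₂ : ProperHomotopic (g₀.comp f₁) (g₁.comp f₁) :=
    ⟨{ toContinuousMap := G.toContinuousMap.comp ((ContinuousMap.id I).prodMap f₁.1)
       map_zero_left := fun x => G.apply_zero (f₁.1 x)
       map_one_left := fun x => G.apply_one (f₁.1 x) },
      hG.comp (isProperMap_id.prodMap f₁.2)⟩
  exact h₁.trans h₂

/-- Proper homotopy as an equivalence relation on proper self-maps. -/
instance properHomotopySetoid (X : Type*) [TopologicalSpace X] : Setoid (ProperMap X X) where
  r := ProperHomotopic
  iseqv := ⟨ProperHomotopic.refl, ProperHomotopic.symm, ProperHomotopic.trans⟩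

end ProperHomotopy

/-- The monoid, under composition, of proper homotopy classes of proper self-maps of `X`. -/
def ProperEnd (X : Type*) [TopologicalSpace X] : Type _ := Quotient (properHomotopySetoid X)

instance ProperEnd.instMonoid (X : Type*) [TopologicalSpace X] : Monoid (ProperEnd X) where
  mul := Quotient.map₂ ProperMap.comp fun _ _ hg _ _ hf => ProperHomotopic.comp hg hf
  one := Quotient.mk _ (ProperMap.id X)
  mul_assoc := by
    rintro ⟨f⟩ ⟨g⟩ ⟨h⟩
    rfl
  one_mul := by
    rintro ⟨f⟩
    rfl
  mul_one := by
    rintro ⟨f⟩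
    rfl

/-- The mapping class group: the group of proper homotopy classes of proper homotopy equivalences
of `X`. A proper map `f` is a proper homotopy equivalence if there is a proper map `g` with `f ∘ g`
and `g ∘ f` properly homotopic to the identity, i.e. if its class is invertible in the monoid of
proper homotopy classes of proper self-maps. -/
abbrev MappingClassGroup (X : Type*) [TopologicalSpace X] : Type _ := (ProperEnd X)ˣ

/-! ### Ends -/

section EndSpace

variable {X : Type*} [TopologicalSpace X]

/-- For compact sets `K ⊆ L`, the map `π₀(X ∖ L) → π₀(X ∖ K)` induced by inclusion. -/
def complComponentsMap {K L : Compacts X} (h : K ≤ L) :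
    ConnectedComponents ((L : Set X)ᶜ : Set X) → ConnectedComponents ((K : Set X)ᶜ : Set X) :=
  (continuous_inclusion (Set.compl_subset_compl.2 h)).connectedComponentsMap

/-- The ends of `X`: the inverse limit of `π₀(X ∖ K)` over the compact subsets `K` of `X`. -/
def EndSpace (X : Type*) [TopologicalSpace X] : Type _ :=
  {e : ∀ K : Compacts X, ConnectedComponents ((K : Set X)ᶜ : Set X) //
    ∀ (K L : Compacts X) (h : K ≤ L), complComponentsMap h (e L) = e K}

/-- The preimage of a compact set under a proper map. -/
def ProperMap.preimage (f : ProperMap X X) (L : Compacts X) : Compacts X :=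
  ⟨f.1 ⁻¹' L, f.2.isCompact_preimage L.isCompact⟩

/-- The map `π₀(X ∖ f⁻¹(L)) → π₀(X ∖ L)` induced by a proper map `f`. -/
def ProperMap.complMap (f : ProperMap X X) (L : Compacts X) :
    ConnectedComponents ((f.preimage L : Set X)ᶜ : Set X) →
      ConnectedComponents ((L : Set X)ᶜ : Set X) :=
  Continuous.connectedComponentsMap
    (f := fun x : ((f.preimage L : Set X)ᶜ : Set X) => (⟨f.1 x.1, x.2⟩ : ((L : Set X)ᶜ : Set X)))
    (by fun_prop)

/-- The action of a proper map `f` on ends: the component of `X ∖ L` determined by the end `f(e)` is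
the one that contains the `f`-image of the component of `X ∖ f⁻¹(L)` determined by `e`. -/
def ProperMap.mapEnd (f : ProperMap X X) (e : EndSpace X) : EndSpace X :=
  ⟨fun L => f.complMap L (e.1 (f.preimage L)), by
    intro K L h
    have h' : f.preimage K ≤ f.preimage L := Set.preimage_mono (f := f.1) h
    change complComponentsMap h (f.complMap L (e.1 (f.preimage L))) =
      f.complMap K (e.1 (f.preimage K))
    rw [← e.2 _ _ h']
    generalize e.1 (f.preimage L) = c
    obtain ⟨x, rfl⟩ := ConnectedComponents.surjective_coe c
    rfl⟩

/-- Properly homotopic maps act in the same way on ends. -/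
theorem ProperHomotopic.mapEnd_eq {f g : ProperMap X X} (h : ProperHomotopic f g)
    (e : EndSpace X) : f.mapEnd e = g.mapEnd e := by
  obtain ⟨H, hH⟩ := h
  apply Subtype.ext
  funext L
  let K : Compacts X := ⟨Prod.snd '' (H ⁻¹' (L : Set X)),
    (hH.isCompact_preimage L.isCompact).image continuous_snd⟩
  have hf : f.preimage L ≤ K := fun x hx => ⟨(0, x), by
    change H (0, x) ∈ (L : Set X)
    rw [H.apply_zero]
    exact hx, rfl⟩
  have hg : g.preimage L ≤ K := fun x hx => ⟨(1, x), by
    change H (1, x) ∈ (L : Set X)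
    rw [H.apply_one]
    exact hx, rfl⟩
  change f.complMap L (e.1 (f.preimage L)) = g.complMap L (e.1 (g.preimage L))
  rw [← e.2 _ _ hf, ← e.2 _ _ hg]
  generalize e.1 K = c
  obtain ⟨x, rfl⟩ := ConnectedComponents.surjective_coe c
  have hx : ∀ t : I, H (t, x.1) ∈ ((L : Set X)ᶜ : Set X) := fun t ht => x.2 ⟨(t, x.1), ht, rfl⟩
  let γ : I → ((L : Set X)ᶜ : Set X) := fun t => ⟨H (t, x.1), hx t⟩
  have hγ : Continuous γ := by
    apply Continuous.subtype_mk
    exact H.continuous.comp (by fun_prop)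
  have key : (γ 0 : ConnectedComponents ((L : Set X)ᶜ : Set X)) = γ 1 :=
    ConnectedComponents.coe_eq_coe'.2
      ((isPreconnected_range hγ).subset_connectedComponent ⟨1, rfl⟩ ⟨0, rfl⟩)
  have e0 : γ 0 = ⟨f.1 x.1, fun hL => x.2 (hf hL)⟩ := Subtype.ext (H.apply_zero x.1)
  have e1 : γ 1 = ⟨g.1 x.1, fun hL => x.2 (hg hL)⟩ := Subtype.ext (H.apply_one x.1)
  rw [e0, e1] at key
  exact key

/-- The action of the proper homotopy classes of proper self-maps (and so of the mapping class
group) on the ends. -/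
instance ProperEnd.instMulAction (X : Type*) [TopologicalSpace X] :
    MulAction (ProperEnd X) (EndSpace X) where
  smul φ e := Quotient.lift (fun f : ProperMap X X => f.mapEnd e)
    (fun _ _ h => ProperHomotopic.mapEnd_eq h e) φ
  one_smul e := by
    apply Subtype.ext
    funext L
    change (ProperMap.id X).complMap L (e.1 L) = e.1 L
    generalize e.1 L = c
    obtain ⟨x, rfl⟩ := ConnectedComponents.surjective_coe c
    rfl
  mul_smul := by
    rintro ⟨f⟩ ⟨g⟩ e
    apply Subtype.ext
    funext L
    change (f.comp g).complMap L (e.1 (g.preimage (f.preimage L))) =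
      f.complMap L (g.complMap (f.preimage L) (e.1 (g.preimage (f.preimage L))))
    generalize e.1 (g.preimage (f.preimage L)) = c
    obtain ⟨x, rfl⟩ := ConnectedComponents.surjective_coe c
    rfl

end EndSpace

/-- The pure mapping class group: the kernel of the action of the mapping class group on the ends,
i.e. the mapping classes that fix every end. -/
def PureMappingClassGroup (X : Type*) [TopologicalSpace X] : Subgroup (MappingClassGroup X) :=
  (MulAction.toPermHom (MappingClassGroup X) (EndSpace X)).ker

/-! ### Graphs as topological spaces -/

/-- A graph, with loops and multiple edges allowed. The orientation of the edges is auxiliary: it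
only serves to parametrize them. -/
structure Multigraph where
  /-- The vertices. -/
  V : Type*
  /-- The edges. -/
  E : Type*
  /-- The initial vertex of an edge. -/
  src : E → V
  /-- The terminal vertex of an edge. -/
  tgt : E → V

namespace Multigraph

variable (Γ : Multigraph)

/-- Every vertex is incident to finitely many edges. -/
def LocallyFinite : Prop := ∀ v : Γ.V, {e : Γ.E | Γ.src e = v ∨ Γ.tgt e = v}.Finite

instance : TopologicalSpace Γ.V := ⊥
instance : TopologicalSpace Γ.E := ⊥
instance : DiscreteTopology Γ.V := ⟨rfl⟩
instance : DiscreteTopology Γ.E := ⟨rfl⟩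

/-- The end points of the interval `{e} × [0,1]` are glued to the end vertices of `e`. -/
inductive Glue : Γ.V ⊕ (Γ.E × I) → Γ.V ⊕ (Γ.E × I) → Prop
  | src (e : Γ.E) : Glue (Sum.inr (e, 0)) (Sum.inl (Γ.src e))
  | tgt (e : Γ.E) : Glue (Sum.inr (e, 1)) (Sum.inl (Γ.tgt e))

/-- The graph as a topological space (a one-dimensional CW complex): the quotient of the disjoint
union of the discrete space of vertices and of one copy of `[0,1]` for each edge, in which the end
points of the intervals are glued to the vertices. -/
def Realization : Type _ := Quot Γ.Glue

instance : TopologicalSpace Γ.Realization := inferInstanceAs (TopologicalSpace (Quot Γ.Glue))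

end Multigraph

/-- The space `X` has infinite rank: no fundamental group of `X` is finitely generated. (For a
connected graph the fundamental group is free and does not depend on the base point, and this says
that its rank is infinite.) -/
def HasInfiniteRank (X : Type*) [TopologicalSpace X] : Prop :=
  ∀ x : X, ¬ Group.FG (FundamentalGroup X x)

/-! ### The Grigorchuk group -/

namespace Grigorchuk

/-- The automorphism `a` of the rooted binary tree, whose vertices are the finite binary words:
it swaps the two subtrees at the root. -/
def a : List Bool → List Bool
  | [] => []
  | x :: w => (!x) :: w

/-- The automorphisms `b = bcd 0`, `c = bcd 1`, `d = bcd 2` of the rooted binary tree, with the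
recursion `b = (a, c)`, `c = (a, d)`, `d = (1, b)`; the two entries are the actions on the subtrees
of the words that begin with `false` and with `true`. -/
def bcd : Fin 3 → List Bool → List Bool
  | _, [] => []
  | i, false :: w => false :: (if i = 2 then w else a w)
  | i, true :: w => true :: bcd (i + 1) w

theorem a_a (w : List Bool) : a (a w) = w := by
  cases w <;> simp [a]

theorem bcd_bcd (i : Fin 3) (w : List Bool) : bcd i (bcd i w) = w := by
  induction w generalizing i with
  | nil => rfl
  | cons x w ih =>
    cases x
    · by_cases h : i = 2 <;> simp [bcd, h, a_a]
    · simp [bcd, ih]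

/-- `a` as a permutation of the vertices of the tree. -/
def aPerm : Equiv.Perm (List Bool) := ⟨a, a, a_a, a_a⟩

/-- `b`, `c`, `d` as permutations of the vertices of the tree. -/
def bcdPerm (i : Fin 3) : Equiv.Perm (List Bool) := ⟨bcd i, bcd i, bcd_bcd i, bcd_bcd i⟩

end Grigorchuk

/-- The (first) Grigorchuk group: the group of automorphisms of the rooted binary tree generated by
`a`, `b`, `c` and `d`. -/
def grigorchukGroup : Subgroup (Equiv.Perm (List Bool)) :=
  Subgroup.closure
    {Grigorchuk.aPerm, Grigorchuk.bcdPerm 0, Grigorchuk.bcdPerm 1, Grigorchuk.bcdPerm 2}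

end

/-!
The graph contains infinitely many disjoint finite blocks, and the block of level `n` contains
edges indexed by the binary words of length `n`, all joined to one vertex of the block by walks
that avoid the indexed edges (`Multigraph.HandleSystem`). A length-preserving permutation `g` of
the binary words acts on the graph by a map that is the identity off the indexed edges and sends
the edge of `w` to the path that runs, within the block, to the edge of `g w`, across it, and back
(`Multigraph.HandleSystem.substMap`). The composite of the maps of `g` and `h` is homotopic to the
map of `g * h`, by a homotopy that moves points only within the blocks. The blocks are compact and
form a locally finite family, so this homotopy is proper (`isProperMap_of_eq_or_mem`), and since
they are connected all ends are fixed (`ProperMap.mapEnd_eq_self`). So every group of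
length-preserving permutations of the binary words, in particular the Grigorchuk group, maps to
the pure mapping class group. The homomorphism is injective
(`Multigraph.HandleSystem.pureHom_injective`): for each edge there is a map to the circle that
wraps this edge once around and is constant elsewhere, and the winding numbers of the images of
the loop across the edge of `w` single out the edge of `g w`.

For the existence of the blocks, infinite rank is first turned into a combinatorial condition: off
every finite set of edges there is a cycle (`Multigraph.HasManyCycles`). Otherwise the graph is a
forest off a finite set `F` of edges, and its fundamental group is generated by one loop for each
edge in `F` (`Multigraph.fundamentalGroup_fg_of_isForest`). Here every path is, up to homotopy,
composed of paths within closed edges (`Multigraph.path_induction`), and there are paths from the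
base point to the vertices that are compatible with the edges of the forest
(`Multigraph.IsForest.exists_compatible_paths`). By local finiteness the condition yields a
sequence of disjoint cycles. All but finitely many of them avoid a given finite set `B` of
vertices, and each of these is joined outside `B` to one of the finitely many neighbours of `B`;
so infinitely many of them are joined outside `B` to the same vertex (`Multigraph.exists_block`).
A walk that meets the distinguished edge of a cycle bypasses it along the rest of that cycle.
-/

noncomputable section

/-! ### The realization of a graph -/

namespace Multigraph

variable {Γ : Multigraph}

/-- The point of the realization given by a vertex. -/
def vtx (v : Γ.V) : Γ.Realization := Quot.mk _ (Sum.inl v)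

/-- The point of the closed edge `e` with parameter `t`. -/
def pt (e : Γ.E) (t : I) : Γ.Realization := Quot.mk _ (Sum.inr (e, t))

theorem pt_zero (e : Γ.E) : pt e 0 = vtx (Γ.src e) := Quot.sound (Glue.src e)

theorem pt_one (e : Γ.E) : pt e 1 = vtx (Γ.tgt e) := Quot.sound (Glue.tgt e)

theorem realization_ind {p : Γ.Realization → Prop} (hv : ∀ v, p (vtx v)) (he : ∀ e t, p (pt e t))
    (x : Γ.Realization) : p x := by
  induction x using Quot.ind with
  | mk a =>
    rcases a with v | ⟨e, t⟩
    · exact hv v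
    · exact he e t

theorem continuous_realization_mk : Continuous (Quot.mk Γ.Glue : _ → Γ.Realization) :=
  continuous_quot_mk

theorem continuous_pt (e : Γ.E) : Continuous (pt e) :=
  continuous_realization_mk.comp (continuous_inr.comp (by fun_prop))

/-- The closed edge `e` as a path between its end vertices. -/
def edgePath (e : Γ.E) : Path (vtx (Γ.src e)) (vtx (Γ.tgt e)) where
  toFun := pt e
  continuous_toFun := continuous_pt e
  source' := pt_zero e
  target' := pt_one e

@[simp] theorem edgePath_apply (e : Γ.E) (t : I) : edgePath e t = pt e t := rfl

variable {Y : Type*} [TopologicalSpace Y]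

/-- The continuous map on the realization that is given on the vertices by `φ` and on each edge
by a path. -/
def lift (φ : Γ.V → Y) (γ : ∀ e, Path (φ (Γ.src e)) (φ (Γ.tgt e))) : C(Γ.Realization, Y) where
  toFun := Quot.lift (Sum.elim φ fun p => γ p.1 p.2) (by
    rintro _ _ (e | e)
    · exact (γ e).source
    · exact (γ e).target)
  continuous_toFun := continuous_quot_lift _ <| continuous_sum_dom.2
    ⟨continuous_of_discreteTopology,
      continuous_prod_of_discrete_left.2 fun e => (γ e).continuous⟩

@[simp] theorem lift_vtx (φ : Γ.V → Y) (γ : ∀ e, Path (φ (Γ.src e)) (φ (Γ.tgt e))) (v : Γ.V) :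
    lift φ γ (vtx v) = φ v := rfl

@[simp] theorem lift_pt (φ : Γ.V → Y) (γ : ∀ e, Path (φ (Γ.src e)) (φ (Γ.tgt e))) (e : Γ.E)
    (t : I) : lift φ γ (pt e t) = γ e t := rfl

theorem pt_or_vtx (x : Γ.Realization) :
    (∃ v, x = vtx v) ∨ ∃ e, ∃ t ∈ Set.Ioo (0 : I) 1, x = pt e t := by
  induction x using realization_ind with
  | hv v => exact Or.inl ⟨v, rfl⟩
  | he e t =>
    rcases eq_or_ne t 0 with rfl | h0
    · exact Or.inl ⟨_, pt_zero e⟩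
    rcases eq_or_ne t 1 with rfl | h1
    · exact Or.inl ⟨_, pt_one e⟩
    · exact Or.inr ⟨e, t, ⟨unitInterval.pos_iff_ne_zero.2 h0,
        unitInterval.lt_one_iff_ne_one.2 h1⟩, rfl⟩

/-- The standard loop in the circle. -/
def circleLoop : Path (1 : Circle) 1 where
  toFun t := Circle.exp (2 * Real.pi * t)
  continuous_toFun := by fun_prop
  source' := by simp
  target' := by simp

open scoped Classical in
/-- The map to the circle that wraps the edge `e` once around the circle and is constant on the
rest of the graph. -/
def wrap (e : Γ.E) : C(Γ.Realization, Circle) :=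
  lift (fun _ => 1) fun e' => if e' = e then circleLoop else Path.refl 1

@[simp] theorem wrap_vtx (e : Γ.E) (v : Γ.V) : wrap e (vtx v) = 1 := rfl

theorem wrap_pt_self (e : Γ.E) (t : I) : wrap e (pt e t) = Circle.exp (2 * Real.pi * t) := by
  simp only [wrap, lift_pt, if_true]
  rfl

theorem wrap_pt_of_ne {e e' : Γ.E} (h : e' ≠ e) (t : I) : wrap e (pt e' t) = 1 := by
  simp [wrap, h]

theorem eq_of_circleExp_eq {a b : ℝ}
    (h : Circle.exp (2 * Real.pi * a) = Circle.exp (2 * Real.pi * b))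
    (h1 : a - b < 1) (h2 : -1 < a - b) : a = b := by
  rw [Circle.exp_eq_exp] at h
  obtain ⟨m, hm⟩ := h
  have hst : a = b + m := by
    have := Real.pi_pos
    have : (2 * Real.pi) * (a - (b + m)) = 0 := by linarith
    rcases mul_eq_zero.1 this with h | h <;> linarith
  have h3 : m < (1 : ℤ) := by
    have : (m : ℝ) < 1 := by linarith
    exact_mod_cast this
  have h4 : (-1 : ℤ) < m := by
    have : (-1 : ℝ) < m := by linarith
    exact_mod_cast this
  have h5 : m = 0 := by omega
  simpa [h5] using hst

theorem eq_of_wrap_pt_eq {e : Γ.E} {s t : I} (ht : t ∈ Set.Ioo (0 : I) 1)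
    (h : wrap e (pt e s) = wrap e (pt e t)) : s = t := by
  rw [wrap_pt_self, wrap_pt_self] at h
  have ht0 : (0 : ℝ) < t := ht.1
  have ht1 : (t : ℝ) < 1 := ht.2
  exact Subtype.ext (eq_of_circleExp_eq h (by linarith [s.2.2]) (by linarith [s.2.1]))

theorem wrap_pt_ne_one (e : Γ.E) {t : I} (ht : t ∈ Set.Ioo (0 : I) 1) : wrap e (pt e t) ≠ 1 := by
  intro h
  have h' : wrap e (pt e 0) = wrap e (pt e t) := by rw [h, pt_zero, wrap_vtx]
  exact ht.1.ne (eq_of_wrap_pt_eq ht h')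

/-- The maps `wrap e` separate the interior points of the edges from all other points. -/
theorem eq_pt_of_wrap_eq {e : Γ.E} {t : I} (ht : t ∈ Set.Ioo (0 : I) 1) {x : Γ.Realization}
    (h : wrap e x = wrap e (pt e t)) : x = pt e t := by
  rcases pt_or_vtx x with ⟨v, rfl⟩ | ⟨e', s, hs, rfl⟩
  · exact absurd h.symm (wrap_pt_ne_one e ht)
  · by_cases he : e' = e
    · subst he
      rw [eq_of_wrap_pt_eq ht h]
    · rw [wrap_pt_of_ne he] at h
      exact absurd h.symm (wrap_pt_ne_one e ht)

theorem pt_eq_pt_interior {e e' : Γ.E} {t t' : I} (ht : t ∈ Set.Ioo (0 : I) 1)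
    (h : pt e' t' = pt e t) : e' = e ∧ t' = t := by
  have hw := wrap_pt_ne_one e ht
  rw [← h] at hw
  have he : e' = e := by
    by_contra he
    exact hw (wrap_pt_of_ne he _)
  subst he
  exact ⟨rfl, eq_of_wrap_pt_eq ht (congrArg (wrap e') h)⟩

open scoped Classical in
/-- A bump function at the vertex `v`, supported on the open star of radius `1/3`. -/
def bump (v : Γ.V) : C(Γ.Realization, ℝ) :=
  lift (fun u => if u = v then 1 else 0) fun e =>
    { toFun := fun t => max (1 - 3 * (t : ℝ)) 0 * (if Γ.src e = v then 1 else 0) +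
        max (3 * (t : ℝ) - 2) 0 * (if Γ.tgt e = v then 1 else 0)
      continuous_toFun := by fun_prop
      source' := by norm_num
      target' := by norm_num }

theorem bump_vtx_self (v : Γ.V) : bump v (vtx v) = 1 := by simp [bump]

theorem bump_vtx_of_ne {u v : Γ.V} (h : u ≠ v) : bump v (vtx u) = 0 := by simp [bump, h]

open scoped Classical in
theorem bump_pt_pos {v : Γ.V} {e : Γ.E} {t : I} (h : 0 < bump v (pt e t)) :
    (Γ.src e = v ∧ (t : ℝ) < 1 / 3) ∨ (Γ.tgt e = v ∧ 2 / 3 < (t : ℝ)) := by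
  by_contra! hc
  refine h.ne' ?_
  simp only [bump, lift_pt]
  change max (1 - 3 * (t : ℝ)) 0 * _ + max (3 * (t : ℝ) - 2) 0 * _ = 0
  have h1 : max (1 - 3 * (t : ℝ)) 0 * (if Γ.src e = v then 1 else 0) = 0 := by
    split_ifs with hs
    · rw [max_eq_right, zero_mul]
      linarith [hc.1 hs]
    · exact mul_zero _
  have h2 : max (3 * (t : ℝ) - 2) 0 * (if Γ.tgt e = v then 1 else 0) = 0 := by
    split_ifs with hs
    · rw [max_eq_right, zero_mul]
      linarith [hc.2 hs]
    · exact mul_zero _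
  rw [h1, h2, add_zero]

theorem vtx_injective : Function.Injective (vtx : Γ.V → Γ.Realization) := by
  intro u v h
  by_contra hne
  have := congrArg (bump v) h
  rw [bump_vtx_of_ne hne, bump_vtx_self] at this
  exact zero_ne_one this

instance : T2Space Γ.Realization := by
  refine T2Space.of_injective_continuous
    (f := fun x : Γ.Realization => ((fun e => wrap e x : Γ.E → Circle),
      (fun v => bump v x : Γ.V → ℝ))) ?_ (by fun_prop)
  intro x y hxy
  have hw : ∀ e, wrap e x = wrap e y := fun e => congrFun (congrArg Prod.fst hxy) e
  have hb : ∀ v, bump v x = bump v y := fun v => congrFun (congrArg Prod.snd hxy) v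
  rcases pt_or_vtx y with ⟨v, rfl⟩ | ⟨e, t, ht, rfl⟩
  · rcases pt_or_vtx x with ⟨u, rfl⟩ | ⟨e, t, ht, rfl⟩
    · by_contra hne
      have := hb v
      rw [bump_vtx_self, bump_vtx_of_ne fun h => hne (by rw [h])] at this
      exact zero_ne_one this
    · exact absurd (hw e) (wrap_pt_ne_one e ht)
  · exact eq_pt_of_wrap_eq ht (hw e)

/-- Homotopies of the paths that are assigned to the edges give a homotopy of maps on the
realization. -/
def liftHomotopy (φ : Γ.V → Y) {γ γ' : ∀ e, Path (φ (Γ.src e)) (φ (Γ.tgt e))}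
    (F : ∀ e, Path.Homotopy (γ e) (γ' e)) :
    ContinuousMap.Homotopy (lift φ γ) (lift φ γ') :=
  let L : C(Γ.Realization, C(I, Y)) := lift (fun v => ContinuousMap.const I (φ v)) fun e =>
    { toContinuousMap := ((F e).toContinuousMap.comp ContinuousMap.prodSwap).curry
      source' := by ext t; exact (F e).source t
      target' := by ext t; exact (F e).target t }
  { toFun := fun p => L p.2 p.1
    continuous_toFun := by fun_prop
    map_zero_left := fun x => by
      induction x using realization_ind with
      | hv v => rfl
      | he e t => exact (F e).apply_zero t
    map_one_left := fun x => by
      induction x using realization_ind with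
      | hv v => rfl
      | he e t => exact (F e).apply_one t }

@[simp] theorem liftHomotopy_vtx (φ : Γ.V → Y) {γ γ' : ∀ e, Path (φ (Γ.src e)) (φ (Γ.tgt e))}
    (F : ∀ e, Path.Homotopy (γ e) (γ' e)) (t : I) (v : Γ.V) :
    liftHomotopy φ F (t, vtx v) = φ v := rfl

@[simp] theorem liftHomotopy_pt (φ : Γ.V → Y) {γ γ' : ∀ e, Path (φ (Γ.src e)) (φ (Γ.tgt e))}
    (F : ∀ e, Path.Homotopy (γ e) (γ' e)) (t s : I) (e : Γ.E) :
    liftHomotopy φ F (t, pt e s) = F e (t, s) := rfl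

end Multigraph

/-! ### Maps supported on a locally finite family of compact sets -/

section LocallyFiniteSupport

variable {X Z ι : Type*} [TopologicalSpace X] [TopologicalSpace Z]

/-- A continuous map that differs from a proper map only within the members of a locally finite
family of compact sets is proper. -/
theorem isProperMap_of_eq_or_mem [T2Space X] {K : ι → Set X} (hK : LocallyFinite K)
    (hc : ∀ i, IsCompact (K i)) {q F : Z → X} (hq : IsProperMap q) (hF : Continuous F)
    (h : ∀ z, F z = q z ∨ ∃ i, q z ∈ K i ∧ F z ∈ K i) : IsProperMap F := by
  rw [isProperMap_iff_ultrafilter]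
  refine ⟨hF, fun 𝒰 y hy => ?_⟩
  suffices hs : ∃ z, (𝒰 : Filter Z) ≤ 𝓝 z by
    obtain ⟨z, hz⟩ := hs
    exact ⟨z, tendsto_nhds_unique ((hF.tendsto z).mono_left hz) hy, hz⟩
  obtain ⟨U, hU, hfin⟩ := hK y
  set C : Set X := ⋃ i ∈ {i | (K i ∩ U).Nonempty}, K i with hC
  have hCc : IsCompact C := hfin.isCompact_biUnion fun i _ => hc i
  have hev : ∀ᶠ z in (𝒰 : Filter Z), F z = q z ∨ q z ∈ C := by
    filter_upwards [hy hU] with z hz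
    refine (h z).imp_right ?_
    rintro ⟨i, hqi, hFi⟩
    exact Set.mem_biUnion (show i ∈ {i | (K i ∩ U).Nonempty} from ⟨F z, hFi, hz⟩) hqi
  rcases Ultrafilter.eventually_or.1 hev with he | he
  · obtain ⟨z, -, hz⟩ := (isProperMap_iff_ultrafilter.1 hq).2 (hy.congr' he)
    exact ⟨z, hz⟩
  · obtain ⟨z, -, hz⟩ := (hq.isCompact_preimage hCc).ultrafilter_le_nhds 𝒰
      (Filter.le_principal_iff.2 he)
    exact ⟨z, hz⟩

/-- A proper map that moves points only within the members of a locally finite family of compact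
connected sets fixes every end. -/
theorem ProperMap.mapEnd_eq_self {K : ι → Set X} (hK : LocallyFinite K)
    (hc : ∀ i, IsCompact (K i)) (hconn : ∀ i, IsPreconnected (K i)) (f : ProperMap X X)
    (h : ∀ x, f.1 x = x ∨ ∃ i, x ∈ K i ∧ f.1 x ∈ K i) (e : EndSpace X) : f.mapEnd e = e := by
  apply Subtype.ext
  funext L
  have hfin : {i | (K i ∩ (L : Set X)).Nonempty}.Finite :=
    hK.finite_nonempty_inter_compact L.isCompact
  let M : Compacts X := ⟨(L : Set X) ∪ ⋃ i ∈ {i | (K i ∩ (L : Set X)).Nonempty}, K i,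
    L.isCompact.union (hfin.isCompact_biUnion fun i _ => hc i)⟩
  have hM : ∀ {x i}, x ∈ K i → x ∉ M → ∀ y ∈ K i, y ∉ (L : Set X) := fun hx hxM y hy hyL =>
    hxM (Or.inr (Set.mem_biUnion (show _ ∈ {i | (K i ∩ (L : Set X)).Nonempty} from ⟨y, hy, hyL⟩)
      hx))
  have hL : L ≤ M := fun x hx => Or.inl hx
  have hfL : f.preimage L ≤ M := by
    intro x hx
    by_contra hxM
    rcases h x with hx' | ⟨i, hi, hfi⟩
    · exact hxM (hL (by simpa [hx'] using show f.1 x ∈ (L : Set X) from hx))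
    · exact hM hi hxM _ hfi hx
  change f.complMap L (e.1 (f.preimage L)) = e.1 L
  rw [← e.2 _ _ hfL, ← e.2 _ _ hL]
  generalize e.1 M = c
  obtain ⟨⟨x, hx⟩, rfl⟩ := ConnectedComponents.surjective_coe c
  have hxL : x ∉ (L : Set X) := fun h => hx (hL h)
  have hfxL : f.1 x ∉ (L : Set X) := fun h => hx (hfL h)
  suffices hs : ((⟨f.1 x, hfxL⟩ : ((L : Set X)ᶜ : Set X)) :
      ConnectedComponents ((L : Set X)ᶜ : Set X)) = (⟨x, hxL⟩ : ((L : Set X)ᶜ : Set X)) from hs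
  rcases h x with hx' | ⟨i, hi, hfi⟩
  · congr 2
  · have hpre : IsPreconnected (((↑) : ((L : Set X)ᶜ : Set X) → X) ⁻¹' K i) := by
      rw [← IsInducing.subtypeVal.isPreconnected_image, Subtype.image_preimage_coe,
        Set.inter_eq_right.2 (show K i ⊆ (L : Set X)ᶜ from hM hi hx)]
      exact hconn i
    exact ConnectedComponents.coe_eq_coe'.2 (hpre.subset_connectedComponent
      (x := ⟨x, hxL⟩) hi (show (⟨f.1 x, hfxL⟩ : ((L : Set X)ᶜ : Set X)) ∈ _ from hfi))

end LocallyFiniteSupport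

/-! ### Connectivity within a set of edges -/

namespace Multigraph

variable {Γ : Multigraph}

/-- Two vertices are adjacent by an edge of `A`, which may be crossed in both directions. -/
def Step (A : Set Γ.E) (u v : Γ.V) : Prop :=
  ∃ e ∈ A, (Γ.src e = u ∧ Γ.tgt e = v) ∨ (Γ.tgt e = u ∧ Γ.src e = v)

/-- Two vertices are joined by a walk all of whose edges belong to `A`. -/
def Conn (A : Set Γ.E) : Γ.V → Γ.V → Prop := Relation.ReflTransGen (Step A)

theorem Step.symm {A : Set Γ.E} {u v : Γ.V} (h : Step A u v) : Step A v u := by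
  obtain ⟨e, he, h | h⟩ := h
  · exact ⟨e, he, Or.inr ⟨h.2, h.1⟩⟩
  · exact ⟨e, he, Or.inl ⟨h.2, h.1⟩⟩

theorem Conn.refl (A : Set Γ.E) (u : Γ.V) : Conn A u u := Relation.ReflTransGen.refl

theorem Conn.symm {A : Set Γ.E} {u v : Γ.V} (h : Conn A u v) : Conn A v u := by
  induction h with
  | refl => exact Relation.ReflTransGen.refl
  | tail _ hs ih => exact Relation.ReflTransGen.head hs.symm ih

theorem Conn.trans {A : Set Γ.E} {u v w : Γ.V} (h : Conn A u v) (h' : Conn A v w) : Conn A u w :=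
  Relation.ReflTransGen.trans h h'

theorem Conn.of_mem {A : Set Γ.E} {e : Γ.E} (he : e ∈ A) : Conn A (Γ.src e) (Γ.tgt e) :=
  Relation.ReflTransGen.single ⟨e, he, Or.inl ⟨rfl, rfl⟩⟩

/-- A walk in `A` can be rerouted through `B`, one edge at a time. -/
theorem Conn.of_forall {A B : Set Γ.E} (h : ∀ e ∈ A, Conn B (Γ.src e) (Γ.tgt e)) {u v : Γ.V}
    (huv : Conn A u v) : Conn B u v := by
  induction huv with
  | refl => exact Conn.refl _ _
  | tail _ hs ih =>
    obtain ⟨e, he, ⟨rfl, rfl⟩ | ⟨rfl, rfl⟩⟩ := hs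
    · exact ih.trans (h e he)
    · exact ih.trans (h e he).symm

theorem Conn.mono {A B : Set Γ.E} (hAB : A ⊆ B) {u v : Γ.V} (h : Conn A u v) : Conn B u v :=
  h.of_forall fun _ he => Conn.of_mem (hAB he)

theorem Conn.exists_finite {A : Set Γ.E} {u v : Γ.V} (h : Conn A u v) :
    ∃ B ⊆ A, B.Finite ∧ Conn B u v := by
  induction h with
  | refl => exact ⟨∅, by simp, by simp, Conn.refl _ _⟩
  | tail _ hs ih =>
    obtain ⟨B, hBA, hB, hc⟩ := ih
    obtain ⟨e, he, h⟩ := hs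
    exact ⟨insert e B, Set.insert_subset he hBA, hB.insert e,
      (hc.mono (Set.subset_insert _ _)).trans
        (Relation.ReflTransGen.single ⟨e, Set.mem_insert _ _, h⟩)⟩

/-- The edges of `A` in the component of `u` suffice to connect `u` to the vertices of that
component. -/
theorem Conn.restrict {A : Set Γ.E} {u v : Γ.V} (h : Conn A u v) :
    Conn {e ∈ A | Conn A u (Γ.src e)} u v := by
  induction h with
  | refl => exact Conn.refl _ _
  | tail h hs ih =>
    obtain ⟨e, he, hs'⟩ := hs
    refine ih.trans (Relation.ReflTransGen.single ⟨e, ⟨he, ?_⟩, hs'⟩)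
    rcases hs' with ⟨rfl, rfl⟩ | ⟨rfl, rfl⟩
    · exact h
    · exact Conn.trans h (Conn.of_mem he).symm

/-- The indicator function of the component of `u` extends to a continuous function on the
realization, which is constant if the realization is connected. -/
theorem conn_univ [ConnectedSpace Γ.Realization] (u v : Γ.V) : Conn Set.univ u v := by
  classical
  let f : C(Γ.Realization, Bool) := lift (fun w => decide (Conn Set.univ u w)) fun e =>
    (Path.refl _).cast rfl (by
      have he : Conn Set.univ (Γ.src e) (Γ.tgt e) := Conn.of_mem trivial
      exact decide_eq_decide.2 ⟨fun h => h.trans he.symm, fun h => h.trans he⟩)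
  have hf : f (vtx u) = f (vtx v) := PreconnectedSpace.constant inferInstance f.continuous
  simpa [f, Conn.refl] using hf

/-- The end vertices of the edges of `A`. -/
def ends (A : Set Γ.E) : Set Γ.V := Γ.src '' A ∪ Γ.tgt '' A

/-- The edges that are incident to no vertex of `B`. -/
def edgesOff (B : Set Γ.V) : Set Γ.E := {e | Γ.src e ∉ B ∧ Γ.tgt e ∉ B}

theorem ends_finite {A : Set Γ.E} (hA : A.Finite) : (ends A).Finite :=
  (hA.image _).union (hA.image _)

theorem src_mem_ends {A : Set Γ.E} {e : Γ.E} (he : e ∈ A) : Γ.src e ∈ ends A :=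
  Or.inl ⟨e, he, rfl⟩

theorem tgt_mem_ends {A : Set Γ.E} {e : Γ.E} (he : e ∈ A) : Γ.tgt e ∈ ends A :=
  Or.inr ⟨e, he, rfl⟩

theorem ends_mono {A B : Set Γ.E} (h : A ⊆ B) : ends A ⊆ ends B :=
  Set.union_subset_union (Set.image_mono h) (Set.image_mono h)

theorem disjoint_ends_of_subset_edgesOff {A : Set Γ.E} {B : Set Γ.V} (h : A ⊆ edgesOff B) :
    Disjoint B (ends A) := by
  rw [Set.disjoint_right]
  rintro _ (⟨e, he, rfl⟩ | ⟨e, he, rfl⟩)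
  · exact (h he).1
  · exact (h he).2

theorem LocallyFinite.finite_compl_edgesOff (hΓ : Γ.LocallyFinite) {B : Set Γ.V} (hB : B.Finite) :
    (edgesOff B : Set Γ.E)ᶜ.Finite := by
  refine (hB.biUnion fun v _ => hΓ v).subset fun e he => ?_
  simp only [edgesOff, Set.mem_compl_iff, Set.mem_ofPred_eq, not_and_or, not_not] at he
  rcases he with he | he
  · exact Set.mem_biUnion he (Or.inl rfl)
  · exact Set.mem_biUnion he (Or.inr rfl)

/-- There are cycles off every finite set of edges: a cycle is an edge `e` together with a walk
between its end vertices that does not contain `e`. -/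
def HasManyCycles (Γ : Multigraph) : Prop :=
  ∀ F : Set Γ.E, F.Finite → ∃ e ∉ F, Conn (F ∪ {e})ᶜ (Γ.src e) (Γ.tgt e)

/-- A sequence of pairwise disjoint cycles. -/
theorem HasManyCycles.exists_seq (h : HasManyCycles Γ) (hΓ : Γ.LocallyFinite) :
    ∃ (ε : ℕ → Γ.E) (C : ℕ → Set Γ.E), (∀ k, (C k).Finite) ∧ (∀ k, ε k ∉ C k) ∧
      (∀ k, Conn (C k) (Γ.src (ε k)) (Γ.tgt (ε k))) ∧
      Pairwise fun j k => Disjoint (ends (insert (ε j) (C j))) (ends (insert (ε k) (C k))) := by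
  let P : Γ.E × Set Γ.E → Prop := fun x =>
    x.2.Finite ∧ x.1 ∉ x.2 ∧ Conn x.2 (Γ.src x.1) (Γ.tgt x.1)
  let r : Γ.E × Set Γ.E → Γ.E × Set Γ.E → Prop := fun x y =>
    Disjoint (ends (insert x.1 x.2)) (ends (insert y.1 y.2))
  have hr : Std.Symm r := ⟨fun x y hxy => hxy.symm⟩
  obtain ⟨f, hf, hfr⟩ := exists_seq_of_forall_finset_exists' P r fun s hs => by
    set B : Set Γ.V := ⋃ x ∈ s, ends (insert x.1 x.2) with hB
    have hBf : B.Finite :=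
      s.finite_toSet.biUnion fun x hx => ends_finite ((hs x hx).1.insert _)
    obtain ⟨e, he, hc⟩ := h _ (hΓ.finite_compl_edgesOff hBf)
    obtain ⟨C, hCs, hCf, hC⟩ := hc.exists_finite
    refine ⟨(e, C), ⟨hCf, fun heC => hCs heC (Or.inr rfl), hC⟩, fun x hx => ?_⟩
    have hsub : insert e C ⊆ edgesOff B := Set.insert_subset (not_not.1 he) fun a ha => by
      by_contra hab
      exact hCs ha (Or.inl hab)
    exact (disjoint_ends_of_subset_edgesOff hsub).mono_left
      (Set.subset_biUnion_of_mem (u := fun x : Γ.E × Set Γ.E => ends (insert x.1 x.2)) hx)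
  exact ⟨fun k => (f k).1, fun k => (f k).2, fun k => (hf k).1, fun k => (hf k).2.1,
    fun k => (hf k).2.2, hfr⟩

/-- Off a nonempty finite set `B` of vertices, every vertex is joined to a neighbour of `B`. -/
theorem exists_conn_neighbour {B : Set Γ.V} {b x : Γ.V} (hb : b ∈ B) (h : Conn Set.univ b x) :
    x ∈ B ∨ ∃ u ∈ ends ((edgesOff B)ᶜ : Set Γ.E) \ B, Conn (edgesOff B) u x := by
  induction h with
  | refl => exact Or.inl hb
  | @tail y z _ hs ih =>
    by_cases hz : z ∈ B
    · exact Or.inl hz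
    right
    rcases ih with hy | ⟨u, hu, hc⟩
    · refine ⟨z, ⟨?_, hz⟩, Conn.refl _ _⟩
      obtain ⟨e, -, ⟨rfl, rfl⟩ | ⟨rfl, rfl⟩⟩ := hs
      · exact tgt_mem_ends fun h => h.1 hy
      · exact src_mem_ends fun h => h.2 hy
    · by_cases hy : y ∈ B
      · refine ⟨z, ⟨?_, hz⟩, Conn.refl _ _⟩
        obtain ⟨e, -, ⟨rfl, rfl⟩ | ⟨rfl, rfl⟩⟩ := hs
        · exact tgt_mem_ends fun h => h.1 hy
        · exact src_mem_ends fun h => h.2 hy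
      · refine ⟨u, hu, hc.tail ?_⟩
        obtain ⟨e, -, ⟨rfl, rfl⟩ | ⟨rfl, rfl⟩⟩ := hs
        · exact ⟨e, ⟨hy, hz⟩, Or.inl ⟨rfl, rfl⟩⟩
        · exact ⟨e, ⟨hz, hy⟩, Or.inr ⟨rfl, rfl⟩⟩

/-- Infinitely many disjoint cycles contain arbitrarily large finite subfamilies that are joined
to a common vertex outside a given finite set of vertices, by walks that avoid the distinguished
edges of all the cycles. -/
theorem exists_block [ConnectedSpace Γ.Realization] [Nonempty Γ.V] (hΓ : Γ.LocallyFinite)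
    {ε : ℕ → Γ.E} {C : ℕ → Set Γ.E} (hCf : ∀ k, (C k).Finite) (hε : ∀ k, ε k ∉ C k)
    (hC : ∀ k, Conn (C k) (Γ.src (ε k)) (Γ.tgt (ε k)))
    (hdisj : Pairwise fun j k => Disjoint (ends (insert (ε j) (C j))) (ends (insert (ε k) (C k))))
    {B : Set Γ.V} (hB : B.Finite) (m : ℕ) :
    ∃ b ∉ B, ∃ J : Finset ℕ, J.card = m ∧ ∃ A : Set Γ.E, A.Finite ∧ A ⊆ edgesOff B ∧
      (∀ k, ε k ∉ A) ∧ ∀ j ∈ J, ε j ∈ edgesOff B ∧ Conn A b (Γ.src (ε j)) ∧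
        Conn A b (Γ.tgt (ε j)) := by
  -- only finitely many cycles meet a finite set, because the cycles are disjoint
  have hmeet : ∀ D : Set Γ.V, D.Finite → {k | ¬ Disjoint D (ends (insert (ε k) (C k)))}.Finite := by
    intro D hD
    have hex : ∀ k, ¬ Disjoint D (ends (insert (ε k) (C k))) →
        ∃ d, d ∈ D ∧ d ∈ ends (insert (ε k) (C k)) := fun k hk => Set.not_disjoint_iff.1 hk
    choose! d hd hd' using hex
    refine Set.Finite.of_injOn (f := d) (fun k hk => hd k hk) (fun j hj k hk hjk => ?_) hD
    by_contra hne
    exact Set.disjoint_left.1 (hdisj hne) (hd' j hj) (hjk ▸ hd' k hk)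
  obtain ⟨b₀⟩ := ‹Nonempty Γ.V›
  set D : Set Γ.V := insert b₀ B with hD
  have hDf : D.Finite := hB.insert b₀
  -- `B'` also contains the cycles that meet `B`, so that outside `B'` a walk can bypass the edge
  -- `ε k` along the cycle `C k` without meeting `B`
  set B' : Set Γ.V := D ∪ ⋃ k ∈ {k | ¬ Disjoint D (ends (insert (ε k) (C k)))},
    ends (insert (ε k) (C k)) with hB'
  have hB'f : B'.Finite :=
    hDf.union ((hmeet D hDf).biUnion fun k _ => ends_finite ((hCf k).insert _))
  set N : Set Γ.V := ends ((edgesOff B')ᶜ : Set Γ.E) with hN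
  have hNf : N.Finite := ends_finite (hΓ.finite_compl_edgesOff hB'f)
  set G : Set ℕ := {k | Disjoint B' (ends (insert (ε k) (C k)))} with hG
  have hGi : G.Infinite := fun hfin => by
    have := (hfin.union (hmeet B' hB'f))
    rw [show G ∪ {k | ¬ Disjoint B' (ends (insert (ε k) (C k)))} = Set.univ from
      Set.union_compl_self G] at this
    exact Set.infinite_univ this
  obtain ⟨u, huB, hu⟩ : ∃ u ∉ B', {k ∈ G | Conn (edgesOff B') u (Γ.src (ε k))}.Infinite := by
    by_contra! hcon
    refine hGi (((hNf.subset (Set.sdiff_subset (t := B'))).biUnion fun u hu =>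
      hcon u hu.2).subset fun k hk => ?_)
    rcases exists_conn_neighbour (B := B') (Or.inl (Set.mem_insert b₀ B))
      (conn_univ b₀ (Γ.src (ε k))) with hx | ⟨u, hu, hc⟩
    · exact absurd (src_mem_ends (Set.mem_insert _ _)) (Set.disjoint_left.1 hk hx)
    · exact Set.mem_biUnion hu ⟨hk, hc⟩
  obtain ⟨J, hJ, hJc⟩ := hu.exists_subset_card_eq m
  have hBB' : B ⊆ B' := (Set.subset_insert b₀ B).trans Set.subset_union_left
  have hoff : ∀ k, Disjoint D (ends (insert (ε k) (C k))) → C k ⊆ edgesOff B \ Set.range ε := by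
    intro k hk a ha
    have hmem : a ∈ insert (ε k) (C k) := Set.mem_insert_of_mem _ ha
    refine ⟨⟨fun h => Set.disjoint_left.1 hk (Set.mem_insert_of_mem b₀ h) (src_mem_ends hmem),
      fun h => Set.disjoint_left.1 hk (Set.mem_insert_of_mem b₀ h) (tgt_mem_ends hmem)⟩, ?_⟩
    rintro ⟨j, rfl⟩
    rcases eq_or_ne j k with rfl | hjk
    · exact hε j ha
    · exact Set.disjoint_left.1 (hdisj hjk) (src_mem_ends (Set.mem_insert _ _))
        (src_mem_ends hmem)
  have hcycle : ∀ k, Disjoint D (ends (insert (ε k) (C k))) →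
      Conn (edgesOff B \ Set.range ε) (Γ.src (ε k)) (Γ.tgt (ε k)) :=
    fun k hk => (hC k).mono (hoff k hk)
  have hbypass : ∀ {x y}, Conn (edgesOff B') x y → Conn (edgesOff B \ Set.range ε) x y := by
    intro x y hxy
    refine hxy.of_forall fun a ha => ?_
    by_cases har : a ∈ Set.range ε
    · obtain ⟨k, rfl⟩ := har
      refine hcycle k (not_not.1 fun hk => ha.1 (Or.inr ?_))
      exact Set.mem_biUnion (show k ∈ {k | ¬ Disjoint D (ends (insert (ε k) (C k)))} from hk)
        (src_mem_ends (Set.mem_insert _ _))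
    · exact Conn.of_mem ⟨⟨fun h => ha.1 (hBB' h), fun h => ha.2 (hBB' h)⟩, har⟩
  have hgood : ∀ j ∈ J, Disjoint D (ends (insert (ε j) (C j))) := fun j hj =>
    (show Disjoint B' _ from (hJ hj).1).mono_left Set.subset_union_left
  have h₁ : ∀ j ∈ J, ∃ A ⊆ edgesOff B \ Set.range ε, A.Finite ∧ Conn A u (Γ.src (ε j)) :=
    fun j hj => (hbypass (hJ hj).2).exists_finite
  have h₂ : ∀ j ∈ J, ∃ A ⊆ edgesOff B \ Set.range ε, A.Finite ∧ Conn A u (Γ.tgt (ε j)) :=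
    fun j hj => ((hbypass (hJ hj).2).trans (hcycle j (hgood j hj))).exists_finite
  choose! A₁ hA₁ hA₁f hA₁c using h₁
  choose! A₂ hA₂ hA₂f hA₂c using h₂
  have hsub : ∀ j ∈ J, A₁ j ∪ A₂ j ⊆ ⋃ j ∈ J, (A₁ j ∪ A₂ j) := fun j hj =>
    Set.subset_biUnion_of_mem (u := fun j => A₁ j ∪ A₂ j) hj
  have hall : ⋃ j ∈ J, (A₁ j ∪ A₂ j) ⊆ edgesOff B \ Set.range ε :=
    Set.iUnion₂_subset fun j hj => Set.union_subset (hA₁ j hj) (hA₂ j hj)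
  refine ⟨u, fun h => huB (hBB' h), J, hJc, ⋃ j ∈ J, (A₁ j ∪ A₂ j),
    J.finite_toSet.biUnion fun j hj => (hA₁f j hj).union (hA₂f j hj),
    hall.trans Set.sdiff_subset, fun k hk => (hall hk).2 ⟨k, rfl⟩, fun j hj => ⟨⟨?_, ?_⟩, ?_, ?_⟩⟩
  · exact fun h => Set.disjoint_left.1 (hgood j hj) (Set.mem_insert_of_mem b₀ h)
      (src_mem_ends (Set.mem_insert _ _))
  · exact fun h => Set.disjoint_left.1 (hgood j hj) (Set.mem_insert_of_mem b₀ h)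
      (tgt_mem_ends (Set.mem_insert _ _))
  · exact (hA₁c j hj).mono (Set.subset_union_left.trans (hsub j hj))
  · exact (hA₂c j hj).mono (Set.subset_union_right.trans (hsub j hj))

/-- Edges `edge w`, indexed by a set `W` with a level function, that are arranged in disjoint
finite blocks: the edges of level `n` are joined to the vertex `base n` by walks in the finite set
`link n`, which contains none of the edges `edge w`, and blocks of different levels have no vertex
in common. -/
structure HandleSystem (Γ : Multigraph) {W : Type*} (level : W → ℕ) where
  /-- The distinguished edges. -/
  edge : W → Γ.E
  /-- The common vertex of the walks of a level. -/
  base : ℕ → Γ.V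
  /-- The edges of the walks of a level. -/
  link : ℕ → Set Γ.E
  edge_injective : Function.Injective edge
  link_finite : ∀ n, (link n).Finite
  edge_notMem : ∀ n w, edge w ∉ link n
  conn_link : ∀ n, ∀ a ∈ link n, Conn (link n) (base n) (Γ.src a)
  conn_src : ∀ w, Conn (link (level w)) (base (level w)) (Γ.src (edge w))
  conn_tgt : ∀ w, Conn (link (level w)) (base (level w)) (Γ.tgt (edge w))
  disjoint : Pairwise fun m n =>
    Disjoint (insert (base m) (ends (link m ∪ edge '' {w | level w = m})))
      (insert (base n) (ends (link n ∪ edge '' {w | level w = n})))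

theorem HasManyCycles.exists_handleSystem [ConnectedSpace Γ.Realization] (h : HasManyCycles Γ)
    (hΓ : Γ.LocallyFinite) : Nonempty (HandleSystem Γ (List.length : List Bool → ℕ)) := by
  obtain ⟨ε, C, hCf, hε, hC, hdisj⟩ := h.exists_seq hΓ
  have hne : Nonempty Γ.V := ⟨Γ.src (ε 0)⟩
  have hεinj : Function.Injective ε := fun j k hjk => by
    by_contra hne
    exact Set.disjoint_left.1 (hdisj hne) (src_mem_ends (Set.mem_insert _ _))
      (hjk ▸ src_mem_ends (Set.mem_insert _ _))
  -- blocks consist of a vertex, a set of indices of cycles and the edges of the connecting walks;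
  -- each block has at least twice as many cycles as its predecessors, so at least `2 ^ n` at
  -- level `n`
  let α := Γ.V × Finset ℕ × Set Γ.E
  let block : α → Set Γ.V := fun x => insert x.1 (ends (x.2.2 ∪ ε '' x.2.1))
  let P : α → Prop := fun x => x.2.2.Finite ∧ (∀ k, ε k ∉ x.2.2) ∧ 0 < x.2.1.card ∧
    ∀ j ∈ x.2.1, Conn x.2.2 x.1 (Γ.src (ε j)) ∧ Conn x.2.2 x.1 (Γ.tgt (ε j))
  let r : α → α → Prop := fun x y => Disjoint (block x) (block y) ∧ 2 * x.2.1.card ≤ y.2.1.card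
  obtain ⟨f, hf, hfr⟩ := exists_seq_of_forall_finset_exists P r fun s hs => by
    set B : Set Γ.V := ⋃ x ∈ s, block x with hB
    have hBf : B.Finite := s.finite_toSet.biUnion fun x hx =>
      (ends_finite ((hs x hx).1.union (x.2.1.finite_toSet.image ε))).insert _
    obtain ⟨b, hb, J, hJ, A, hAf, hAB, hεA, hJA⟩ :=
      exists_block hΓ hCf hε hC hdisj hBf (∑ x ∈ s, 2 * x.2.1.card + 1)
    refine ⟨(b, J, A), ⟨hAf, hεA, by simp only; omega, fun j hj => (hJA j hj).2⟩,
      fun x hx => ⟨?_, ?_⟩⟩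
    · refine Set.disjoint_of_subset_left (Set.subset_biUnion_of_mem (u := block) hx) ?_
      rw [Set.disjoint_insert_right]
      refine ⟨hb, disjoint_ends_of_subset_edgesOff (Set.union_subset hAB ?_)⟩
      rintro _ ⟨j, hj, rfl⟩
      exact (hJA j hj).1
    · have := Finset.single_le_sum (f := fun x : α => 2 * x.2.1.card) (fun _ _ => Nat.zero_le _) hx
      simp only at this ⊢
      omega
  have hcard : ∀ n, 2 ^ n ≤ (f n).2.1.card := by
    intro n
    induction n with
    | zero => exact (hf 0).2.2.1
    | succ n ih =>
      have := (hfr n (n + 1) n.lt_succ_self).2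
      rw [pow_succ]
      omega
  have hemb : ∀ n, Nonempty (List.Vector Bool n ↪ (f n).2.1) := fun n =>
    Function.Embedding.nonempty_of_card_le (by simpa using hcard n)
  let g : ∀ n, List.Vector Bool n ↪ (f n).2.1 := fun n => (hemb n).some
  let idx : List Bool → ℕ := fun w => g w.length ⟨w, rfl⟩
  have hidx : ∀ w, idx w ∈ (f w.length).2.1 := fun w => (g w.length ⟨w, rfl⟩).2
  have hsub : ∀ n, insert (f n).1 (ends ({e ∈ (f n).2.2 | Conn (f n).2.2 (f n).1 (Γ.src e)} ∪
      (fun w => ε (idx w)) '' {w : List Bool | w.length = n})) ⊆ block (f n) := by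
    refine fun n => Set.insert_subset_insert (ends_mono
      (Set.union_subset_union (Set.sep_subset _ _) ?_))
    rintro _ ⟨w, rfl, rfl⟩
    exact ⟨idx w, hidx w, rfl⟩
  have hdisj' : Pairwise fun m n => Disjoint (block (f m)) (block (f n)) := by
    intro m n hmn
    rcases lt_or_gt_of_ne hmn with h | h
    · exact (hfr m n h).1
    · exact (hfr n m h).1.symm
  refine ⟨⟨fun w => ε (idx w), fun n => (f n).1, fun n =>
    {e ∈ (f n).2.2 | Conn (f n).2.2 (f n).1 (Γ.src e)}, fun w w' hww => ?_,
    fun n => (hf n).1.subset (Set.sep_subset _ _), fun n w hw => (hf n).2.1 _ hw.1,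
    fun n a ha => ha.2.restrict, fun w => ((hf _).2.2.2 _ (hidx w)).1.restrict,
    fun w => ((hf _).2.2.2 _ (hidx w)).2.restrict, fun m n hmn => ?_⟩⟩
  · replace hww : idx w = idx w' := hεinj hww
    have hlen : w.length = w'.length := by
      by_contra hne
      refine Set.not_disjoint_iff.2 ⟨Γ.src (ε (idx w)), ?_, ?_⟩ (hdisj' hne)
      · exact Or.inr (src_mem_ends (Or.inr ⟨_, hidx w, rfl⟩))
      · exact Or.inr (src_mem_ends (Or.inr ⟨_, hidx w', by rw [hww]⟩))
    have key : ∀ n (hn : w.length = n), idx w = g n ⟨w, hn⟩ := by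
      rintro n rfl
      rfl
    have := (g w'.length).injective (Subtype.ext ((key _ hlen).symm.trans hww))
    exact congrArg Subtype.val this
  · exact (hdisj' hmn).mono (hsub m) (hsub n)

end Multigraph

/-! ### Homotopies of paths within a subset -/

section HomotopicIn

variable {X : Type*} [TopologicalSpace X]

/-- Two paths are homotopic, relative to their end points, by a homotopy with values in `K`. -/
def Path.HomotopicIn (K : Set X) {x y : X} (p q : Path x y) : Prop :=
  ∃ F : Path.Homotopy p q, ∀ z, F z ∈ K

/-- A path with values in `K`, as a path in the subspace `K`. -/
def Path.codRestrict {K : Set X} {x y : X} (p : Path x y) (h : ∀ t, p t ∈ K) (hx : x ∈ K)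
    (hy : y ∈ K) : Path (⟨x, hx⟩ : K) ⟨y, hy⟩ where
  toFun t := ⟨p t, h t⟩
  continuous_toFun := p.continuous.subtype_mk _
  source' := Subtype.ext p.source
  target' := Subtype.ext p.target

theorem Path.HomotopicIn.of_map {K : Set X} {x y : K} {p q : Path x y} (h : p.Homotopic q) :
    Path.HomotopicIn K (p.map continuous_subtype_val) (q.map continuous_subtype_val) := by
  obtain ⟨F⟩ := h
  exact ⟨F.map ⟨_, continuous_subtype_val⟩, fun z => (F z).2⟩

theorem Path.exists_eq_map_val {K : Set X} {x y : K} (p : Path (x : X) y) (h : ∀ t, p t ∈ K) :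
    ∃ p' : Path x y, p = p'.map continuous_subtype_val :=
  ⟨p.codRestrict h x.2 y.2, rfl⟩

/-- The path `m` with its ends transported along paths: from the end of `a` back along `a`, along
`a'` to the start of `m`, along `m`, then back along `b'`, and along `b`. -/
def Path.transport {u v x y x' y' : X} (a : Path u x) (b : Path v y) (a' : Path u x')
    (b' : Path v y') (m : Path x' y') : Path x y :=
  a.symm.trans (a'.trans (m.trans (b'.symm.trans b)))

theorem Path.transport_self_homotopic {u v x y : X} (a : Path u x) (b : Path v y)
    (m : Path x y) : (Path.transport a b a b m).Homotopic m := by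
  rw [← Path.Homotopic.Quotient.eq]
  simp only [Path.transport, Path.Homotopic.Quotient.mk_trans, Path.Homotopic.Quotient.mk_symm]
  simp [← Path.Homotopic.Quotient.trans_assoc]

theorem Path.transport_transport_homotopic {u v x y x' y' x'' y'' : X} (a : Path u x)
    (b : Path v y) (a' : Path u x') (b' : Path v y') (a'' : Path u x'') (b'' : Path v y'')
    (m : Path x'' y'') :
    (Path.transport a b a' b' (Path.transport a' b' a'' b'' m)).Homotopic
      (Path.transport a b a'' b'' m) := by
  rw [← Path.Homotopic.Quotient.eq]
  simp only [Path.transport, Path.Homotopic.Quotient.mk_trans, Path.Homotopic.Quotient.mk_symm]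
  simp [← Path.Homotopic.Quotient.trans_assoc]
  rw [Path.Homotopic.Quotient.trans_assoc _ (Path.Homotopic.Quotient.mk b'),
    Path.Homotopic.Quotient.trans_symm, Path.Homotopic.Quotient.trans_refl]

theorem Path.transport_self_homotopicIn {K : Set X} {u v x y : X} {a : Path u x} {b : Path v y}
    {m : Path x y} (ha : ∀ t, a t ∈ K) (hb : ∀ t, b t ∈ K) (hm : ∀ t, m t ∈ K) :
    Path.HomotopicIn K (Path.transport a b a b m) m := by
  lift u to K using a.source ▸ ha 0
  lift v to K using b.source ▸ hb 0
  lift x to K using a.target ▸ ha 1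
  lift y to K using b.target ▸ hb 1
  obtain ⟨a, rfl⟩ := a.exists_eq_map_val ha
  obtain ⟨b, rfl⟩ := b.exists_eq_map_val hb
  obtain ⟨m, rfl⟩ := m.exists_eq_map_val hm
  have := Path.HomotopicIn.of_map (Path.transport_self_homotopic a b m)
  simpa only [Path.transport, Path.map_trans, Path.map_symm] using this

theorem Path.transport_transport_homotopicIn {K : Set X} {u v x y x' y' x'' y'' : X}
    {a : Path u x} {b : Path v y} {a' : Path u x'} {b' : Path v y'} {a'' : Path u x''}
    {b'' : Path v y''} {m : Path x'' y''} (ha : ∀ t, a t ∈ K) (hb : ∀ t, b t ∈ K)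
    (ha' : ∀ t, a' t ∈ K) (hb' : ∀ t, b' t ∈ K) (ha'' : ∀ t, a'' t ∈ K) (hb'' : ∀ t, b'' t ∈ K)
    (hm : ∀ t, m t ∈ K) :
    Path.HomotopicIn K (Path.transport a b a' b' (Path.transport a' b' a'' b'' m))
      (Path.transport a b a'' b'' m) := by
  lift u to K using a.source ▸ ha 0
  lift v to K using b.source ▸ hb 0
  lift x to K using a.target ▸ ha 1
  lift y to K using b.target ▸ hb 1
  lift x' to K using a'.target ▸ ha' 1
  lift y' to K using b'.target ▸ hb' 1
  lift x'' to K using a''.target ▸ ha'' 1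
  lift y'' to K using b''.target ▸ hb'' 1
  obtain ⟨a, rfl⟩ := a.exists_eq_map_val ha
  obtain ⟨b, rfl⟩ := b.exists_eq_map_val hb
  obtain ⟨a', rfl⟩ := a'.exists_eq_map_val ha'
  obtain ⟨b', rfl⟩ := b'.exists_eq_map_val hb'
  obtain ⟨a'', rfl⟩ := a''.exists_eq_map_val ha''
  obtain ⟨b'', rfl⟩ := b''.exists_eq_map_val hb''
  obtain ⟨m, rfl⟩ := m.exists_eq_map_val hm
  have := Path.HomotopicIn.of_map (Path.transport_transport_homotopic a b a' b' a'' b'' m)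
  simpa only [Path.transport, Path.map_trans, Path.map_symm] using this

theorem Path.map_trans_apply {f : X → X} {x y z : X} {p p' : Path x y} {q q' : Path y z}
    (hp : ∀ t, f (p t) = p' t) (hq : ∀ t, f (q t) = q' t) (t : I) :
    f (p.trans q t) = p'.trans q' t := by
  rw [Path.trans_apply, Path.trans_apply]
  split_ifs
  · exact hp _
  · exact hq _

theorem Path.map_transport_apply {f : X → X} {u v x y x' y' : X} {a : Path u x} {b : Path v y}
    {a' : Path u x'} {b' : Path v y'} {m m' : Path x' y'} (ha : ∀ t, f (a t) = a t)
    (hb : ∀ t, f (b t) = b t) (ha' : ∀ t, f (a' t) = a' t) (hb' : ∀ t, f (b' t) = b' t)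
    (hm : ∀ t, f (m t) = m' t) (t : I) :
    f (Path.transport a b a' b' m t) = Path.transport a b a' b' m' t := by
  have ha₁ : ∀ t, f (a.symm t) = a.symm t := fun t => ha (σ t)
  have hb₁ : ∀ t, f (b'.symm t) = b'.symm t := fun t => hb' (σ t)
  have h₁ := Path.map_trans_apply (f := f) hb₁ hb
  have h₂ := Path.map_trans_apply (f := f) hm h₁
  have h₃ := Path.map_trans_apply (f := f) ha' h₂
  exact Path.map_trans_apply (f := f) ha₁ h₃ t

theorem Path.trans_mem {K : Set X} {x y z : X} {p : Path x y} {q : Path y z} (hp : ∀ t, p t ∈ K)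
    (hq : ∀ t, q t ∈ K) (t : I) : p.trans q t ∈ K := by
  rw [Path.trans_apply]
  split_ifs
  · exact hp _
  · exact hq _

theorem Path.symm_mem {K : Set X} {x y : X} {p : Path x y} (hp : ∀ t, p t ∈ K) (t : I) :
    p.symm t ∈ K := hp _

theorem Path.transport_mem {K : Set X} {u v x y x' y' : X} {a : Path u x} {b : Path v y}
    {a' : Path u x'} {b' : Path v y'} {m : Path x' y'} (ha : ∀ t, a t ∈ K) (hb : ∀ t, b t ∈ K)
    (ha' : ∀ t, a' t ∈ K) (hb' : ∀ t, b' t ∈ K) (hm : ∀ t, m t ∈ K) (t : I) :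
    Path.transport a b a' b' m t ∈ K :=
  Path.trans_mem (Path.symm_mem ha) (Path.trans_mem ha' (Path.trans_mem hm
    (Path.trans_mem (Path.symm_mem hb') hb))) t

end HomotopicIn

/-! ### The blocks of a handle system -/

namespace Multigraph

variable {Γ : Multigraph}

/-- The closed subset of the realization that consists of the vertex `b` and of the closed edges
in `A`. -/
def carrier (b : Γ.V) (A : Set Γ.E) : Set Γ.Realization :=
  insert (vtx b) (⋃ e ∈ A, Set.range (pt e))

theorem pt_mem_carrier {b : Γ.V} {A : Set Γ.E} {e : Γ.E} (he : e ∈ A) (t : I) :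
    pt e t ∈ carrier b A :=
  Or.inr (Set.mem_biUnion he ⟨t, rfl⟩)

theorem vtx_mem_carrier (b : Γ.V) (A : Set Γ.E) : vtx b ∈ carrier b A := Set.mem_insert _ _

theorem carrier_mono (b : Γ.V) {A B : Set Γ.E} (h : A ⊆ B) : carrier b A ⊆ carrier b B :=
  Set.insert_subset_insert (Set.biUnion_subset_biUnion_left h)

theorem isCompact_carrier (b : Γ.V) {A : Set Γ.E} (hA : A.Finite) : IsCompact (carrier b A) :=
  (hA.isCompact_biUnion fun e _ => isCompact_range (continuous_pt e)).insert _

theorem joinedIn_carrier {b : Γ.V} {A : Set Γ.E} {v : Γ.V} (h : Conn A b v) :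
    JoinedIn (carrier b A) (vtx b) (vtx v) := by
  induction h with
  | refl => exact JoinedIn.refl (vtx_mem_carrier b A)
  | tail _ hs ih =>
    obtain ⟨e, he, hs⟩ := hs
    have hj : JoinedIn (carrier b A) (vtx (Γ.src e)) (vtx (Γ.tgt e)) :=
      ⟨edgePath e, fun t => pt_mem_carrier he t⟩
    rcases hs with ⟨rfl, rfl⟩ | ⟨rfl, rfl⟩
    · exact ih.trans hj
    · exact ih.trans hj.symm

theorem isPreconnected_carrier {b : Γ.V} {A : Set Γ.E} (h : ∀ e ∈ A, Conn A b (Γ.src e)) :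
    IsPreconnected (carrier b A) := by
  suffices h : IsPathConnected (carrier b A) from h.isConnected.isPreconnected
  refine ⟨vtx b, vtx_mem_carrier b A, fun {x} hx => ?_⟩
  rcases hx with rfl | hx
  · exact JoinedIn.refl (vtx_mem_carrier b A)
  · simp only [Set.mem_iUnion] at hx
    obtain ⟨e, he, t, rfl⟩ := hx
    refine (joinedIn_carrier (h e he)).trans ?_
    have : PathConnectedSpace I :=
      isPathConnected_iff_pathConnectedSpace.1 ((convex_Icc 0 1).isPathConnected ⟨0, by simp⟩)
    have hr : IsPathConnected (Set.range (pt e)) := isPathConnected_range (continuous_pt e)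
    exact (hr.joinedIn _ ⟨0, pt_zero e⟩ _ ⟨t, rfl⟩).mono fun x ⟨s, hs⟩ => hs ▸ pt_mem_carrier he s

theorem mem_ends_of_bump_pos {b v : Γ.V} {A : Set Γ.E} {x : Γ.Realization} (hx : x ∈ carrier b A)
    (h : 0 < bump v x) : v ∈ insert b (ends A) := by
  rcases hx with rfl | hx
  · by_contra hv
    rw [bump_vtx_of_ne fun hbv => hv (Or.inl hbv.symm)] at h
    exact h.false
  · simp only [Set.mem_iUnion] at hx
    obtain ⟨e, he, t, rfl⟩ := hx
    rcases bump_pt_pos h with ⟨rfl, -⟩ | ⟨rfl, -⟩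
    · exact Or.inr (src_mem_ends he)
    · exact Or.inr (tgt_mem_ends he)

theorem mem_of_wrap_ne_one {b : Γ.V} {A : Set Γ.E} {e : Γ.E} {x : Γ.Realization}
    (hx : x ∈ carrier b A) (h : wrap e x ≠ 1) : e ∈ A := by
  rcases hx with rfl | hx
  · exact absurd (wrap_vtx e b) h
  · simp only [Set.mem_iUnion] at hx
    obtain ⟨e', he, t, rfl⟩ := hx
    by_cases hee : e' = e
    · exact hee ▸ he
    · exact absurd (wrap_pt_of_ne hee t) h

theorem locallyFinite_carrier {ι : Type*} {b : ι → Γ.V} {A : ι → Set Γ.E}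
    (h : Pairwise fun i j => Disjoint (insert (b i) (ends (A i))) (insert (b j) (ends (A j)))) :
    _root_.LocallyFinite fun i => carrier (b i) (A i) := by
  have hss : ∀ v, {i | v ∈ insert (b i) (ends (A i))}.Subsingleton := fun v i hi j hj => by
    by_contra hij
    exact Set.disjoint_left.1 (h hij) hi hj
  intro x
  rcases pt_or_vtx x with ⟨v, rfl⟩ | ⟨e, t, ht, rfl⟩
  · refine ⟨{x | 0 < bump v x}, ?_, (hss v).finite.subset ?_⟩
    · refine (isOpen_lt continuous_const (bump v).continuous).mem_nhds ?_
      change 0 < bump v (vtx v)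
      rw [bump_vtx_self]
      exact one_pos
    · rintro i ⟨x, hx, hxv⟩
      exact mem_ends_of_bump_pos hx hxv
  · refine ⟨{x | wrap e x ≠ 1}, ?_, (hss (Γ.src e)).finite.subset ?_⟩
    · exact (isOpen_ne_fun (wrap e).continuous continuous_const).mem_nhds (wrap_pt_ne_one e ht)
    · rintro i ⟨x, hx, hxe⟩
      exact Or.inr (src_mem_ends (mem_of_wrap_ne_one hx hxe))

namespace HandleSystem

variable {W : Type*} {level : W → ℕ} (S : HandleSystem Γ level)

/-- The edges of the block of level `n`. -/
def blockEdges (n : ℕ) : Set Γ.E := S.link n ∪ S.edge '' {w | level w = n}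

/-- The compact connected subset of the realization formed by the block of level `n`. -/
def block (n : ℕ) : Set Γ.Realization := carrier (S.base n) (S.blockEdges n)

theorem locallyFinite_block : _root_.LocallyFinite S.block := locallyFinite_carrier S.disjoint

theorem isCompact_block (hW : ∀ n, {w | level w = n}.Finite) (n : ℕ) : IsCompact (S.block n) :=
  isCompact_carrier _ ((S.link_finite n).union ((hW n).image _))

theorem isPreconnected_block (n : ℕ) : IsPreconnected (S.block n) := by
  refine isPreconnected_carrier ?_
  rintro e (he | ⟨w, rfl, rfl⟩)
  · exact (S.conn_link n e he).mono Set.subset_union_left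
  · exact (S.conn_src w).mono Set.subset_union_left

theorem pt_edge_mem_block (w : W) (t : I) : pt (S.edge w) t ∈ S.block (level w) :=
  pt_mem_carrier (Or.inr ⟨w, rfl, rfl⟩) t

theorem linkCarrier_subset (n : ℕ) : carrier (S.base n) (S.link n) ⊆ S.block n :=
  carrier_mono _ Set.subset_union_left

/-- A path from the base vertex to the initial vertex of a distinguished edge. -/
def srcPath {n : ℕ} {w : W} (h : level w = n) : Path (vtx (S.base n)) (vtx (Γ.src (S.edge w))) :=
  (joinedIn_carrier (h ▸ S.conn_src w)).somePath

/-- A path from the base vertex to the terminal vertex of a distinguished edge. -/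
def tgtPath {n : ℕ} {w : W} (h : level w = n) : Path (vtx (S.base n)) (vtx (Γ.tgt (S.edge w))) :=
  (joinedIn_carrier (h ▸ S.conn_tgt w)).somePath

theorem srcPath_mem {n : ℕ} {w : W} (h : level w = n) (t : I) :
    S.srcPath h t ∈ carrier (S.base n) (S.link n) :=
  (joinedIn_carrier (h ▸ S.conn_src w)).somePath_mem t

theorem tgtPath_mem {n : ℕ} {w : W} (h : level w = n) (t : I) :
    S.tgtPath h t ∈ carrier (S.base n) (S.link n) :=
  (joinedIn_carrier (h ▸ S.conn_tgt w)).somePath_mem t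

/-- The path between the end vertices of `edge w` that crosses `edge w'` instead. -/
def detour {n : ℕ} {w w' : W} (h : level w = n) (h' : level w' = n) :
    Path (vtx (Γ.src (S.edge w))) (vtx (Γ.tgt (S.edge w))) :=
  Path.transport (S.srcPath h) (S.tgtPath h) (S.srcPath h') (S.tgtPath h') (edgePath (S.edge w'))

open scoped Classical in
/-- The path assigned to the edge `e` by a level-preserving map `g` of the index set. -/
def substPath (g : W → W) (hg : ∀ w, level (g w) = level w) (e : Γ.E) :
    Path (vtx (Γ.src e)) (vtx (Γ.tgt e)) :=
  if h : ∃ w, S.edge w = e then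
    (S.detour rfl (hg h.choose)).cast (congrArg (vtx ∘ Γ.src) h.choose_spec.symm)
      (congrArg (vtx ∘ Γ.tgt) h.choose_spec.symm)
  else edgePath e

theorem substPath_edge (g : W → W) (hg : ∀ w, level (g w) = level w) (w : W) :
    S.substPath g hg (S.edge w) = S.detour rfl (hg w) := by
  have h : ∃ w', S.edge w' = S.edge w := ⟨w, rfl⟩
  have key : ∀ w' (hw : S.edge w' = S.edge w), (S.detour rfl (hg w')).cast
      (congrArg (vtx ∘ Γ.src) hw.symm) (congrArg (vtx ∘ Γ.tgt) hw.symm) =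
        S.detour rfl (hg w) := by
    intro w' hw
    obtain rfl := S.edge_injective hw
    rfl
  rw [substPath, dif_pos h]
  exact key h.choose h.choose_spec

theorem substPath_of_notMem (g : W → W) (hg : ∀ w, level (g w) = level w) {e : Γ.E}
    (he : e ∉ Set.range S.edge) : S.substPath g hg e = edgePath e :=
  dif_neg he

/-- The map of the realization that sends each distinguished edge `edge w` to a path that crosses
`edge (g w)` and is the identity off the distinguished edges. -/
def substMap (g : W → W) (hg : ∀ w, level (g w) = level w) : C(Γ.Realization, Γ.Realization) :=
  lift vtx (S.substPath g hg)

theorem substMap_pt_edge (g : W → W) (hg : ∀ w, level (g w) = level w) (w : W) (t : I) :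
    S.substMap g hg (pt (S.edge w) t) = S.detour rfl (hg w) t := by
  rw [substMap, lift_pt, substPath_edge]

theorem substMap_pt_of_notMem (g : W → W) (hg : ∀ w, level (g w) = level w) {e : Γ.E}
    (he : e ∉ Set.range S.edge) (t : I) : S.substMap g hg (pt e t) = pt e t := by
  rw [substMap, lift_pt, substPath_of_notMem _ _ _ he, edgePath_apply]

theorem substMap_eq_self (g : W → W) (hg : ∀ w, level (g w) = level w) {n : ℕ}
    {x : Γ.Realization} (hx : x ∈ carrier (S.base n) (S.link n)) : S.substMap g hg x = x := by
  rcases hx with rfl | hx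
  · rfl
  · simp only [Set.mem_iUnion] at hx
    obtain ⟨e, he, t, rfl⟩ := hx
    refine S.substMap_pt_of_notMem g hg ?_ t
    rintro ⟨w, rfl⟩
    exact S.edge_notMem _ _ he

theorem detour_mem {n : ℕ} {w w' : W} (h : level w = n) (h' : level w' = n) (t : I) :
    S.detour h h' t ∈ S.block n := by
  refine Path.transport_mem (fun t => ?_) (fun t => ?_) (fun t => ?_) (fun t => ?_)
    (fun t => ?_) t
  · exact S.linkCarrier_subset n (S.srcPath_mem h t)
  · exact S.linkCarrier_subset n (S.tgtPath_mem h t)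
  · exact S.linkCarrier_subset n (S.srcPath_mem h' t)
  · exact S.linkCarrier_subset n (S.tgtPath_mem h' t)
  · subst h'
    exact S.pt_edge_mem_block w' t

theorem substMap_eq_or_mem (g : W → W) (hg : ∀ w, level (g w) = level w) (x : Γ.Realization) :
    S.substMap g hg x = x ∨ ∃ n, x ∈ S.block n ∧ S.substMap g hg x ∈ S.block n := by
  induction x using realization_ind with
  | hv v => exact Or.inl rfl
  | he e t =>
    by_cases he : e ∈ Set.range S.edge
    · obtain ⟨w, rfl⟩ := he
      rw [substMap_pt_edge]
      exact Or.inr ⟨_, S.pt_edge_mem_block w t, S.detour_mem _ _ t⟩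
    · exact Or.inl (S.substMap_pt_of_notMem g hg he t)

/-- `substMap` as a proper map. -/
def substProperMap (hW : ∀ n, {w | level w = n}.Finite) (g : W → W)
    (hg : ∀ w, level (g w) = level w) : ProperMap Γ.Realization Γ.Realization :=
  ⟨S.substMap g hg, isProperMap_of_eq_or_mem S.locallyFinite_block (S.isCompact_block hW)
    isProperMap_id (S.substMap g hg).continuous (S.substMap_eq_or_mem g hg)⟩

/-- Maps that agree with the identity off the distinguished edges, and whose values on each
distinguished edge are homotopic within the block of that edge, are properly homotopic: the union
of the homotopies is proper because the blocks are compact and form a locally finite family. -/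
theorem properHomotopic_of_homotopicIn (hW : ∀ n, {w | level w = n}.Finite)
    {γ γ' : ∀ e, Path (vtx (Γ.src e)) (vtx (Γ.tgt e))}
    {f f' : ProperMap Γ.Realization Γ.Realization} (hf : f.1 = lift vtx γ)
    (hf' : f'.1 = lift vtx γ')
    (h : ∀ e ∉ Set.range S.edge, γ e = edgePath e ∧ γ' e = edgePath e)
    (h' : ∀ w, Path.HomotopicIn (S.block (level w)) (γ (S.edge w)) (γ' (S.edge w))) :
    ProperHomotopic f f' := by
  have hex : ∀ e, ∃ F : Path.Homotopy (γ e) (γ' e), ∀ z : I × I, F z = pt e z.2 ∨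
      ∃ n, pt e z.2 ∈ S.block n ∧ F z ∈ S.block n := by
    intro e
    by_cases he : e ∈ Set.range S.edge
    · obtain ⟨w, rfl⟩ := he
      obtain ⟨F, hF⟩ := h' w
      exact ⟨F, fun z => Or.inr ⟨_, S.pt_edge_mem_block w _, hF z⟩⟩
    · rw [(h e he).1, (h e he).2]
      exact ⟨Path.Homotopy.refl _, fun z => Or.inl rfl⟩
  choose F hF using hex
  obtain ⟨f, hfp⟩ := f
  obtain ⟨f', hfp'⟩ := f'
  simp only at hf hf'
  subst hf hf'
  refine ⟨liftHomotopy vtx F, isProperMap_of_eq_or_mem S.locallyFinite_block (S.isCompact_block hW)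
    (q := Prod.snd) isProperMap_snd_of_compactSpace (ContinuousMap.continuous _) ?_⟩
  rintro ⟨t, x⟩
  induction x using realization_ind with
  | hv v => exact Or.inl rfl
  | he e s => exact hF e (t, s)

theorem srcPath_mem_block {n : ℕ} {w : W} (h : level w = n) (t : I) : S.srcPath h t ∈ S.block n :=
  S.linkCarrier_subset n (S.srcPath_mem h t)

theorem tgtPath_mem_block {n : ℕ} {w : W} (h : level w = n) (t : I) : S.tgtPath h t ∈ S.block n :=
  S.linkCarrier_subset n (S.tgtPath_mem h t)

theorem substProperMap_id (hW : ∀ n, {w | level w = n}.Finite) :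
    ProperHomotopic (S.substProperMap hW id fun _ => rfl) (ProperMap.id Γ.Realization) := by
  refine S.properHomotopic_of_homotopicIn hW (γ' := edgePath) rfl ?_
    (fun e he => ⟨S.substPath_of_notMem _ _ he, rfl⟩) fun w => ?_
  · ext x
    induction x using realization_ind with
    | hv v => rfl
    | he e t => rfl
  · rw [substPath_edge]
    exact Path.transport_self_homotopicIn (S.srcPath_mem_block _) (S.tgtPath_mem_block _)
      (S.pt_edge_mem_block w)

theorem substMap_detour (g : W → W) (hg : ∀ w, level (g w) = level w) {n : ℕ} {w w' : W}
    (h : level w = n) (h' : level w' = n) (t : I) :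
    S.substMap g hg (S.detour h h' t) = Path.transport (S.srcPath h) (S.tgtPath h) (S.srcPath h')
      (S.tgtPath h') (S.detour h' ((hg w').trans h')) t := by
  subst h'
  refine Path.map_transport_apply (fun t => ?_) (fun t => ?_) (fun t => ?_) (fun t => ?_)
    (fun t => S.substMap_pt_edge g hg w' t) t
  · exact S.substMap_eq_self g hg (S.srcPath_mem _ t)
  · exact S.substMap_eq_self g hg (S.tgtPath_mem _ t)
  · exact S.substMap_eq_self g hg (S.srcPath_mem _ t)
  · exact S.substMap_eq_self g hg (S.tgtPath_mem _ t)

theorem substProperMap_comp (hW : ∀ n, {w | level w = n}.Finite) (g h : W → W)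
    (hg : ∀ w, level (g w) = level w) (hh : ∀ w, level (h w) = level w) :
    ProperHomotopic ((S.substProperMap hW g hg).comp (S.substProperMap hW h hh))
      (S.substProperMap hW (g ∘ h) fun w => (hg _).trans (hh w)) := by
  refine S.properHomotopic_of_homotopicIn hW
    (γ := fun e => (S.substPath h hh e).map (S.substMap g hg).continuous) ?_ rfl
    (fun e he => ⟨?_, S.substPath_of_notMem _ _ he⟩) fun w => ?_
  · ext x
    induction x using realization_ind with
    | hv v => rfl
    | he e t => rfl
  · ext t
    change S.substMap g hg (S.substPath h hh e t) = pt e t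
    rw [S.substPath_of_notMem h hh he, edgePath_apply, S.substMap_pt_of_notMem g hg he]
  · have he : (S.substPath h hh (S.edge w)).map (S.substMap g hg).continuous =
        Path.transport (S.srcPath rfl) (S.tgtPath rfl) (S.srcPath (hh w))
          (S.tgtPath (hh w)) (S.detour (hh w) ((hg _).trans (hh w))) := by
      ext t
      change S.substMap g hg (S.substPath h hh (S.edge w) t) = _
      rw [substPath_edge, substMap_detour]
      rfl
    rw [he, substPath_edge]
    exact Path.transport_transport_homotopicIn (S.srcPath_mem_block _) (S.tgtPath_mem_block _)
      (S.srcPath_mem_block _) (S.tgtPath_mem_block _) (S.srcPath_mem_block _)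
      (S.tgtPath_mem_block _) fun t => by
        have := S.pt_edge_mem_block (g (h w)) t
        rwa [hg, hh] at this

/-- The action of the level-preserving permutations in `G` by classes of proper maps. -/
def substHom (hW : ∀ n, {w | level w = n}.Finite) (G : Subgroup (Equiv.Perm W))
    (hG : ∀ g ∈ G, ∀ w, level (g w) = level w) : G →* ProperEnd Γ.Realization where
  toFun g := Quotient.mk _ (S.substProperMap hW g.1 (hG g.1 g.2))
  map_one' := Quotient.sound (S.substProperMap_id hW)
  map_mul' g h := (Quotient.sound
    (S.substProperMap_comp hW g.1 h.1 (hG g.1 g.2) (hG h.1 h.2))).symm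

/-- The homomorphism to the pure mapping class group: the maps `substMap` fix all ends because they
move points only within the blocks, which are compact and connected. -/
def pureHom (hW : ∀ n, {w | level w = n}.Finite) (G : Subgroup (Equiv.Perm W))
    (hG : ∀ g ∈ G, ∀ w, level (g w) = level w) : G →* PureMappingClassGroup Γ.Realization :=
  (S.substHom hW G hG).toHomUnits.codRestrict _ fun g => by
    rw [PureMappingClassGroup, MonoidHom.mem_ker]
    ext e : 1
    exact ProperMap.mapEnd_eq_self S.locallyFinite_block (S.isCompact_block hW)
      S.isPreconnected_block (S.substProperMap hW g.1 (hG g.1 g.2))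
      (S.substMap_eq_or_mem g.1 (hG g.1 g.2)) e

end HandleSystem

end Multigraph

/-! ### Winding numbers -/

section Winding

/-- The total angle, in full turns, along a path `u` in the circle is `d`. -/
def HasWinding (u : I → Circle) (d : ℝ) : Prop :=
  ∃ θ : C(I, ℝ), (∀ t, u t = Circle.exp (2 * Real.pi * θ t)) ∧ θ 1 - θ 0 = d

theorem hasWinding_of_eq_one {u : I → Circle} (h : ∀ t, u t = 1) : HasWinding u 0 :=
  ⟨0, fun t => by simp [h t], by simp⟩

theorem HasWinding.trans {X : Type*} [TopologicalSpace X] {f : X → Circle} {x y z : X}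
    {p : Path x y} {q : Path y z} {d d' : ℝ} (hp : HasWinding (fun t => f (p t)) d)
    (hq : HasWinding (fun t => f (q t)) d') : HasWinding (fun t => f (p.trans q t)) (d + d') := by
  obtain ⟨θ, hθ, rfl⟩ := hp
  obtain ⟨η, hη, rfl⟩ := hq
  let P : Path (θ 0) (θ 1) := ⟨θ, rfl, rfl⟩
  let Q : Path (θ 1) (η 1 + (θ 1 - η 0)) :=
    ⟨⟨fun t => η t + (θ 1 - η 0), by fun_prop⟩, by simp, rfl⟩
  have hshift : Circle.exp (2 * Real.pi * (θ 1 - η 0)) = 1 := by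
    have h1 := hθ 1
    have h0 := hη 0
    simp only [p.target, q.source] at h1 h0
    rw [mul_sub, Circle.exp_sub, ← h1, ← h0, div_self']
  refine ⟨P.trans Q, fun t => ?_, ?_⟩
  · change f (p.trans q t) = Circle.exp (2 * Real.pi * P.trans Q t)
    rw [Path.trans_apply, Path.trans_apply]
    split_ifs
    · exact hθ _
    · refine (hη _).trans ?_
      change _ = Circle.exp (2 * Real.pi * (η _ + (θ 1 - η 0)))
      rw [mul_add, Circle.exp_add, hshift, mul_one]
  · change P.trans Q 1 - P.trans Q 0 = _
    rw [Path.target, Path.source]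
    ring

theorem eq_of_continuous_of_forall_int {f : I → ℝ} (hf : Continuous f) (h : ∀ t, ∃ m : ℤ, f t = m)
    (s t : I) : f s = f t := by
  choose m hm using h
  have hmc : Continuous m := by
    rw [Int.isClosedEmbedding_coe_real.isInducing.continuous_iff]
    exact hf.congr hm
  rw [hm, hm, PreconnectedSpace.constant inferInstance hmc (x := s) (y := t)]

theorem exists_int_of_circleExp_eq {a b : ℝ}
    (h : Circle.exp (2 * Real.pi * a) = Circle.exp (2 * Real.pi * b)) : ∃ m : ℤ, a - b = m := by
  rw [Circle.exp_eq_exp] at h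
  obtain ⟨m, hm⟩ := h
  refine ⟨m, ?_⟩
  have := Real.pi_pos
  have : (2 * Real.pi) * (a - b - m) = 0 := by linarith
  rcases mul_eq_zero.1 this with h | h <;> linarith

/-- The winding number is invariant under free homotopies of loops. -/
theorem HasWinding.eq_of_homotopy {G : C(I × I, Circle)} (hG : ∀ t, G (t, 0) = G (t, 1)) {d d' : ℝ}
    (h₀ : HasWinding (fun s => G (0, s)) d) (h₁ : HasWinding (fun s => G (1, s)) d') : d = d' := by
  obtain ⟨θ, hθ, rfl⟩ := h₀
  obtain ⟨η, hη, rfl⟩ := h₁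
  -- in a lift of `G`, the angle between the two ends of the loop at time `t` is an integral
  -- number of turns, so it does not depend on `t`; at `t = 1` the lift differs from `η` by a
  -- constant
  let f : C(I, ℝ) := ⟨fun s => 2 * Real.pi * θ s, by fun_prop⟩
  let L : C(I × I, ℝ) := Circle.isCoveringMap_exp.liftHomotopy G f hθ
  have hL : ∀ z, Circle.exp (L z) = G z := fun z =>
    congrFun (Circle.isCoveringMap_exp.liftHomotopy_lifts G f hθ) z
  have hL0 : ∀ s, L (0, s) = f s := Circle.isCoveringMap_exp.liftHomotopy_zero G f hθ
  have hpi : 2 * Real.pi ≠ 0 := by positivity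
  let M : I × I → ℝ := fun z => L z / (2 * Real.pi)
  have hM : ∀ z, G z = Circle.exp (2 * Real.pi * M z) := fun z => by
    rw [mul_div_cancel₀ _ hpi, hL]
  have hMc : Continuous M := by fun_prop
  have hM0 : ∀ s, M (0, s) = θ s := fun s => by
    simp only [M, hL0]
    exact mul_div_cancel_left₀ _ hpi
  have e₁ := eq_of_continuous_of_forall_int (f := fun t => M (t, 1) - M (t, 0)) (by fun_prop)
    (fun t => exists_int_of_circleExp_eq (by rw [← hM, ← hM, hG])) 0 1
  have e₂ := eq_of_continuous_of_forall_int (f := fun s => M (1, s) - η s) (by fun_prop)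
    (fun s => exists_int_of_circleExp_eq (by rw [← hM, ← hη])) 0 1
  simp only [hM0] at e₁
  linarith

end Winding

namespace Multigraph.HandleSystem

variable {Γ : Multigraph} {W : Type*} {level : W → ℕ} (S : HandleSystem Γ level)

theorem wrap_edge_eq_one (w : W) {n : ℕ} {x : Γ.Realization}
    (hx : x ∈ carrier (S.base n) (S.link n)) : wrap (S.edge w) x = 1 := by
  by_contra h
  exact S.edge_notMem n w (mem_of_wrap_ne_one hx h)

/-- The loop from the base vertex of a level across a distinguished edge. -/
def handleLoop (w : W) : Path (vtx (S.base (level w)) : Γ.Realization) (vtx (S.base (level w))) :=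
  (S.srcPath rfl).trans ((edgePath (S.edge w)).trans (S.tgtPath rfl).symm)

open scoped Classical in
/-- `substMap g` sends the loop across `edge w` to a loop that winds once around `edge (g w)`, and
not at all around the other distinguished edges. -/
theorem hasWinding_substMap_handleLoop (g : W → W) (hg : ∀ w, level (g w) = level w) (w w' : W) :
    HasWinding (fun t => wrap (S.edge w') (S.substMap g hg (S.handleLoop w t)))
      (if g w = w' then 1 else 0) := by
  have hsrc : ∀ {n : ℕ} {w : W} (h : level w = n),
      HasWinding (fun t => wrap (S.edge w') (S.srcPath h t)) 0 := fun h =>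
    hasWinding_of_eq_one fun t => S.wrap_edge_eq_one w' (S.srcPath_mem h t)
  have htgt : ∀ {n : ℕ} {w : W} (h : level w = n),
      HasWinding (fun t => wrap (S.edge w') (S.tgtPath h t)) 0 := fun h =>
    hasWinding_of_eq_one fun t => S.wrap_edge_eq_one w' (S.tgtPath_mem h t)
  have hsrc' : ∀ {n : ℕ} {w : W} (h : level w = n),
      HasWinding (fun t => wrap (S.edge w') ((S.srcPath h).symm t)) 0 := fun h =>
    hasWinding_of_eq_one fun t => S.wrap_edge_eq_one w' (S.srcPath_mem h _)
  have htgt' : ∀ {n : ℕ} {w : W} (h : level w = n),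
      HasWinding (fun t => wrap (S.edge w') ((S.tgtPath h).symm t)) 0 := fun h =>
    hasWinding_of_eq_one fun t => S.wrap_edge_eq_one w' (S.tgtPath_mem h _)
  have hedge : HasWinding (fun t => wrap (S.edge w') (edgePath (S.edge (g w)) t))
      (if g w = w' then 1 else 0) := by
    split_ifs with h
    · subst h
      exact ⟨⟨fun t => t, by fun_prop⟩, fun t => wrap_pt_self _ t, by simp⟩
    · exact hasWinding_of_eq_one fun t => wrap_pt_of_ne (S.edge_injective.ne h) t
  have hdet : HasWinding (fun t => wrap (S.edge w') (S.detour rfl (hg w) t))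
      (if g w = w' then 1 else 0) := by
    have := (hsrc' (rfl : level w = _)).trans ((hsrc (hg w)).trans
      (hedge.trans ((htgt' (hg w)).trans (htgt rfl))))
    simp only [zero_add, add_zero] at this
    exact this
  have hloop := (hsrc (rfl : level w = _)).trans (hdet.trans (htgt' rfl))
  rw [zero_add, add_zero] at hloop
  have htgtfix : ∀ t, S.substMap g hg ((S.tgtPath (rfl : level w = _)).symm t) =
      (S.tgtPath rfl).symm t := fun t => S.substMap_eq_self g hg (S.tgtPath_mem rfl (σ t))
  have heq : ∀ t, S.substMap g hg (S.handleLoop w t) =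
      ((S.srcPath rfl).trans ((S.detour rfl (hg w)).trans (S.tgtPath rfl).symm)) t :=
    Path.map_trans_apply (fun t => S.substMap_eq_self g hg (S.srcPath_mem rfl t))
      (Path.map_trans_apply (fun t => S.substMap_pt_edge g hg w t) htgtfix)
  simpa only [heq] using hloop

/-- The classes of the maps `substMap g` determine `g`, because the free homotopy class of the image
of the loop across `edge w` determines `g w`. -/
theorem eq_of_properHomotopic (hW : ∀ n, {w | level w = n}.Finite) {g h : W → W}
    {hg : ∀ w, level (g w) = level w} {hh : ∀ w, level (h w) = level w}
    (H : ProperHomotopic (S.substProperMap hW g hg) (S.substProperMap hW h hh)) : g = h := by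
  classical
  funext w
  by_contra hne
  obtain ⟨H, -⟩ := H
  let G : C(I × I, Circle) :=
    ⟨fun z => wrap (S.edge (g w)) (H (z.1, S.handleLoop w z.2)), by fun_prop⟩
  have h₀ : HasWinding (fun s => G (0, s)) 1 := by
    have := S.hasWinding_substMap_handleLoop g hg w (g w)
    rw [if_pos rfl] at this
    convert this using 3 with s
    exact congrArg (wrap (S.edge (g w))) (H.apply_zero _)
  have h₁ : HasWinding (fun s => G (1, s)) 0 := by
    have := S.hasWinding_substMap_handleLoop h hh w (g w)
    rw [if_neg (Ne.symm hne)] at this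
    convert this using 3 with s
    exact congrArg (wrap (S.edge (g w))) (H.apply_one _)
  have hG : ∀ t, G (t, 0) = G (t, 1) := fun t => by simp [G]
  exact one_ne_zero (HasWinding.eq_of_homotopy hG h₀ h₁)

theorem pureHom_injective (hW : ∀ n, {w | level w = n}.Finite) (G : Subgroup (Equiv.Perm W))
    (hG : ∀ g ∈ G, ∀ w, level (g w) = level w) : Function.Injective (S.pureHom hW G hG) := by
  intro g h hgh
  have h₁ : S.substHom hW G hG g = S.substHom hW G hG h :=
    congrArg (fun x : PureMappingClassGroup Γ.Realization => (x.1 : ProperEnd Γ.Realization)) hgh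
  exact Subtype.ext (DFunLike.coe_injective (S.eq_of_properHomotopic hW (Quotient.exact h₁)))

end Multigraph.HandleSystem

/-! ### Potentials on forests -/

namespace Multigraph

variable {Γ : Multigraph} {G : Type*} [Group G]

/-- `g` is the product of the labels along a walk in `A` from `u` to `v`. -/
inductive WalkLabel (lab : Γ.E → G) (A : Set Γ.E) (u : Γ.V) : Γ.V → G → Prop
  | refl : WalkLabel lab A u u 1
  | fwd {g : G} {e : Γ.E} (he : e ∈ A) (h : WalkLabel lab A u (Γ.src e) g) :
      WalkLabel lab A u (Γ.tgt e) (g * lab e)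
  | bwd {g : G} {e : Γ.E} (he : e ∈ A) (h : WalkLabel lab A u (Γ.tgt e) g) :
      WalkLabel lab A u (Γ.src e) (g * (lab e)⁻¹)

/-- A set of edges is a forest if each of its edges separates its end vertices. -/
def IsForest (A : Set Γ.E) : Prop := ∀ e ∈ A, ¬ Conn (A \ {e}) (Γ.src e) (Γ.tgt e)

theorem IsForest.mono {A B : Set Γ.E} (hB : IsForest B) (h : A ⊆ B) : IsForest A :=
  fun e he hc => hB e (h he) (hc.mono (Set.sdiff_subset_sdiff_left h))

theorem WalkLabel.mono {lab : Γ.E → G} {A B : Set Γ.E} (hAB : A ⊆ B) {u v : Γ.V} {g : G}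
    (h : WalkLabel lab A u v g) : WalkLabel lab B u v g := by
  induction h with
  | refl => exact .refl
  | fwd he _ ih => exact .fwd (hAB he) ih
  | bwd he _ ih => exact .bwd (hAB he) ih

theorem WalkLabel.exists_finite {lab : Γ.E → G} {A : Set Γ.E} {u v : Γ.V} {g : G}
    (h : WalkLabel lab A u v g) : ∃ B ⊆ A, B.Finite ∧ WalkLabel lab B u v g := by
  induction h with
  | refl => exact ⟨∅, Set.empty_subset _, Set.finite_empty, .refl⟩
  | @fwd g e he _ ih =>
    obtain ⟨B, hBA, hB, hw⟩ := ih
    exact ⟨insert e B, Set.insert_subset he hBA, hB.insert e,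
      .fwd (Set.mem_insert _ _) (hw.mono (Set.subset_insert _ _))⟩
  | @bwd g e he _ ih =>
    obtain ⟨B, hBA, hB, hw⟩ := ih
    exact ⟨insert e B, Set.insert_subset he hBA, hB.insert e,
      .bwd (Set.mem_insert _ _) (hw.mono (Set.subset_insert _ _))⟩

theorem exists_walkLabel (lab : Γ.E → G) {A : Set Γ.E} {u v : Γ.V} (h : Conn A u v) :
    ∃ g, WalkLabel lab A u v g := by
  induction h with
  | refl => exact ⟨1, .refl⟩
  | tail _ hs ih =>
    obtain ⟨g, hg⟩ := ih
    obtain ⟨e, he, ⟨rfl, rfl⟩ | ⟨rfl, rfl⟩⟩ := hs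
    · exact ⟨_, .fwd he hg⟩
    · exact ⟨_, .bwd he hg⟩

theorem WalkLabel.eq_of_potential {lab : Γ.E → G} {A : Set Γ.E} {p : Γ.V → G}
    (hp : ∀ e ∈ A, p (Γ.src e) * lab e = p (Γ.tgt e)) {u v : Γ.V} {g : G}
    (h : WalkLabel lab A u v g) : p u * g = p v := by
  induction h with
  | refl => exact mul_one _
  | fwd he _ ih => rw [← mul_assoc, ih, hp _ he]
  | bwd he _ ih => rw [← mul_assoc, ih, ← hp _ he, mul_inv_cancel_right]

/-- On a finite forest there is a potential for any labelling of the edges by a group: when an edge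
is added, the potential can be adjusted on the component of its terminal vertex. -/
theorem IsForest.exists_potential_of_finite (lab : Γ.E → G) {A : Set Γ.E} (hA : A.Finite) :
    IsForest A → ∃ p : Γ.V → G, ∀ e ∈ A, p (Γ.src e) * lab e = p (Γ.tgt e) := by
  classical
  induction A, hA using Set.Finite.induction_on with
  | empty => exact fun _ => ⟨1, by simp⟩
  | @insert e A he _ ih =>
    intro hf
    obtain ⟨p, hp⟩ := ih (hf.mono (Set.subset_insert _ _))
    have hsub : A ⊆ insert e A \ {e} := fun a ha =>
      ⟨Set.mem_insert_of_mem _ ha, fun h => he (Set.mem_singleton_iff.1 h ▸ ha)⟩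
    have hsep : ¬ Conn A (Γ.src e) (Γ.tgt e) := fun hc =>
      hf e (Set.mem_insert _ _) (hc.mono hsub)
    refine ⟨fun v => if Conn A (Γ.tgt e) v then
      p (Γ.src e) * lab e * (p (Γ.tgt e))⁻¹ * p v else p v, ?_⟩
    rintro a (rfl | ha)
    · beta_reduce
      rw [if_neg fun h : Conn A (Γ.tgt a) (Γ.src a) => hsep h.symm, if_pos (Conn.refl _ _),
        inv_mul_cancel_right]
    · have hiff : Conn A (Γ.tgt e) (Γ.src a) ↔ Conn A (Γ.tgt e) (Γ.tgt a) :=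
        ⟨fun h => h.trans (Conn.of_mem ha), fun h => h.trans (Conn.of_mem ha).symm⟩
      beta_reduce
      by_cases h : Conn A (Γ.tgt e) (Γ.src a)
      · rw [if_pos h, if_pos (hiff.1 h), mul_assoc, hp a ha]
      · rw [if_neg h, if_neg (mt hiff.2 h), hp a ha]

theorem IsForest.walkLabel_unique {lab : Γ.E → G} {A : Set Γ.E} (hA : IsForest A) {u v : Γ.V}
    {g h : G} (hg : WalkLabel lab A u v g) (hh : WalkLabel lab A u v h) : g = h := by
  obtain ⟨B, hBA, hB, hg⟩ := hg.exists_finite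
  obtain ⟨C, hCA, hC, hh⟩ := hh.exists_finite
  obtain ⟨p, hp⟩ := (hA.mono (Set.union_subset hBA hCA)).exists_potential_of_finite lab
    (hB.union hC)
  have h₁ := (hg.mono Set.subset_union_left).eq_of_potential hp
  have h₂ := (hh.mono Set.subset_union_right).eq_of_potential hp
  exact mul_left_cancel (h₁.trans h₂.symm)

/-- On a forest there is a potential for any labelling of the edges by a group: the labels of the
walks from a root of each component. -/
theorem IsForest.exists_potential (lab : Γ.E → G) {A : Set Γ.E} (hA : IsForest A) :
    ∃ p : Γ.V → G, ∀ e ∈ A, p (Γ.src e) * lab e = p (Γ.tgt e) := by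
  let s : Setoid Γ.V := ⟨Conn A, ⟨Conn.refl A, Conn.symm, Conn.trans⟩⟩
  have hroot : ∀ v, ∃ g, WalkLabel lab A (Quotient.mk s v).out v g := fun v =>
    exists_walkLabel lab (Quotient.exact (Quotient.out_eq (Quotient.mk s v)))
  choose p hp using hroot
  refine ⟨p, fun e he => ?_⟩
  have hr : Quotient.mk s (Γ.src e) = Quotient.mk s (Γ.tgt e) := Quotient.sound (Conn.of_mem he)
  have h₁ := (hp (Γ.src e)).fwd he
  rw [hr] at h₁
  exact hA.walkLabel_unique h₁ (hp _)

end Multigraph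

/-! ### Paths in a graph are composed of paths in closed edges -/

namespace Multigraph

variable {Γ : Multigraph}

theorem isOpenEmbedding_pt (e : Γ.E) :
    IsOpenEmbedding fun t : Set.Ioo (0 : I) 1 => (pt e t : Γ.Realization) := by
  refine .of_continuous_injective_isOpenMap ((continuous_pt e).comp continuous_subtype_val)
    (fun s t h => Subtype.ext (pt_eq_pt_interior t.2 h).2) fun O hO => ?_
  have hO' : IsOpen (((↑) : Set.Ioo (0 : I) 1 → I) '' O) :=
    isOpen_Ioo.isOpenMap_subtype_val O hO
  refine isOpen_coinduced.2 (isOpen_sum_iff.2 ⟨isOpen_discrete _, ?_⟩)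
  convert (isOpen_discrete ({e} : Set Γ.E)).prod hO' using 1
  ext ⟨e', t'⟩
  constructor
  · rintro ⟨t, ht, h⟩
    obtain ⟨rfl, rfl⟩ := pt_eq_pt_interior t.2 h.symm
    exact ⟨rfl, t, ht, rfl⟩
  · rintro ⟨he, t, ht, rfl⟩
    obtain rfl : e' = e := he
    exact ⟨t, ht, rfl⟩

/-- A path that stays in an open edge has a continuous parameter. -/
theorem exists_continuous_parameter {e : Γ.E} {u : I → Γ.Realization} (hu : Continuous u)
    (h : ∀ s, wrap e (u s) ≠ 1) : ∃ θ : C(I, I), ∀ s, u s = pt e (θ s) := by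
  have hex : ∀ s, ∃ t : Set.Ioo (0 : I) 1, pt e t = u s := by
    intro s
    rcases pt_or_vtx (u s) with ⟨v, hv⟩ | ⟨e', t, ht, htu⟩
    · exact absurd (by rw [hv, wrap_vtx]) (h s)
    · by_cases hee : e' = e
      · subst hee
        exact ⟨⟨t, ht⟩, htu.symm⟩
      · exact absurd (by rw [htu, wrap_pt_of_ne hee]) (h s)
  choose θ hθ using hex
  have hc : Continuous θ := by
    rw [(isOpenEmbedding_pt e).isInducing.continuous_iff]
    exact hu.congr fun s => (hθ s).symm
  exact ⟨⟨fun s => θ s, continuous_subtype_val.comp hc⟩, fun s => (hθ s).symm⟩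

/-- The reparametrization of an edge that is constant on the first and the last third. -/
def stretch (s : I) : I := Set.projIcc 0 1 zero_le_one (3 * (s : ℝ) - 1)

theorem continuous_stretch : Continuous stretch := continuous_projIcc.comp (by fun_prop)

theorem stretch_of_le {s : I} (h : (s : ℝ) ≤ 1 / 3) : stretch s = 0 :=
  Set.projIcc_of_le_left _ (by linarith)

theorem stretch_of_ge {s : I} (h : 2 / 3 ≤ (s : ℝ)) : stretch s = 1 :=
  Set.projIcc_of_right_le _ (by linarith)

theorem stretch_zero : stretch 0 = 0 := stretch_of_le (by norm_num)

theorem stretch_one : stretch 1 = 1 := stretch_of_ge (by norm_num)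

variable (Γ) in
/-- The map of the realization, homotopic to the identity, that collapses the star of radius `1/3`
of each vertex to that vertex. -/
def collapse : C(Γ.Realization, Γ.Realization) :=
  lift vtx fun e => (edgePath e).reparam stretch continuous_stretch stretch_zero stretch_one

theorem collapse_pt (e : Γ.E) (t : I) : collapse Γ (pt e t) = pt e (stretch t) := rfl

variable (Γ) in
/-- The homotopy from the identity to `collapse`, which fixes the vertices. -/
def collapseHomotopy : ContinuousMap.Homotopy (lift vtx edgePath) (collapse Γ) :=
  liftHomotopy vtx fun e =>
    Path.Homotopy.reparam (edgePath e) stretch continuous_stretch stretch_zero stretch_one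

theorem collapse_of_bump_pos {v : Γ.V} {x : Γ.Realization} (h : 0 < bump v x) :
    collapse Γ x = vtx v := by
  induction x using realization_ind with
  | hv u =>
    by_contra hne
    rw [bump_vtx_of_ne fun huv => hne (by rw [huv]; rfl)] at h
    exact h.false
  | he e t =>
    rw [collapse_pt]
    rcases bump_pt_pos h with ⟨rfl, ht⟩ | ⟨rfl, ht⟩
    · rw [stretch_of_le ht.le, pt_zero]
    · rw [stretch_of_ge ht.le, pt_one]

/-- The image under `collapse` of a path between vertices. -/
def collapsePath {u v : Γ.V} (γ : Path (vtx u : Γ.Realization) (vtx v)) :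
    Path (vtx u : Γ.Realization) (vtx v) where
  toFun s := collapse Γ (γ s)
  continuous_toFun := by fun_prop
  source' := by rw [γ.source]; rfl
  target' := by rw [γ.target]; rfl

theorem lift_vtx_edgePath (x : Γ.Realization) : lift vtx edgePath x = x := by
  induction x using realization_ind with
  | hv v => rfl
  | he e t => rfl

theorem homotopic_collapsePath {u v : Γ.V} (γ : Path (vtx u : Γ.Realization) (vtx v)) :
    γ.Homotopic (collapsePath γ) :=
  ⟨{ toFun := fun z => collapseHomotopy Γ (z.1, γ z.2)
     continuous_toFun := by fun_prop
     map_zero_left := fun s => ((collapseHomotopy Γ).apply_zero _).trans (lift_vtx_edgePath _)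
     map_one_left := fun s => (collapseHomotopy Γ).apply_one _
     prop' := by
      rintro t s (rfl | rfl)
      · change collapseHomotopy Γ (t, γ 0) = γ 0
        rw [γ.source]
        rfl
      · change collapseHomotopy Γ (t, γ 1) = γ 1
        rw [γ.target]
        rfl }⟩

/-- A property of homotopy classes of paths that is preserved by concatenation and holds for
constant paths and for paths in closed edges holds for all paths between vertices. -/
theorem path_induction
    {P : ∀ {x y : Γ.Realization}, Path.Homotopic.Quotient x y → Prop}
    (htrans : ∀ {x y z} (a : Path.Homotopic.Quotient x y) (b : Path.Homotopic.Quotient y z),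
      P a → P b → P (a.trans b))
    (hrefl : ∀ x, P (Path.Homotopic.Quotient.refl x))
    (hedge : ∀ (e : Γ.E) {s t : I} (θ : Path s t),
      P (Path.Homotopic.Quotient.mk (θ.map (continuous_pt e))))
    {u v : Γ.V} (γ : Path (vtx u : Γ.Realization) (vtx v)) :
    P (Path.Homotopic.Quotient.mk γ) := by
  have hconst : ∀ {x y : Γ.Realization} (p : Path x y) (w), (∀ t, p t = w) →
      P (Path.Homotopic.Quotient.mk p) := by
    intro x y p w hp
    obtain rfl : x = w := p.source.symm.trans (hp 0)
    obtain rfl : y = x := p.target.symm.trans (hp 1)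
    obtain rfl : p = Path.refl y := by
      ext t
      exact hp t
    exact hrefl y
  have hpiece : ∀ {x y : Γ.Realization} (p : Path x y) (e : Γ.E) (θ : C(I, I)),
      (∀ t, p t = pt e (θ t)) → P (Path.Homotopic.Quotient.mk p) := by
    intro x y p e θ hp
    obtain rfl : pt e (θ 0) = x := (hp 0).symm.trans p.source
    obtain rfl : pt e (θ 1) = y := (hp 1).symm.trans p.target
    obtain rfl : p = (⟨θ, rfl, rfl⟩ : Path (θ 0) (θ 1)).map (continuous_pt e) := by
      ext t
      exact hp t
    exact hedge e _
  have hcongr : ∀ {x y x' y' : Γ.Realization} (p : Path x y) (q : Path x' y'), (∀ t, p t = q t) →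
      P (Path.Homotopic.Quotient.mk p) → P (Path.Homotopic.Quotient.mk q) := by
    intro x y x' y' p q hpq hp
    obtain rfl : x = x' := by rw [← p.source, ← q.source, hpq]
    obtain rfl : y = y' := by rw [← p.target, ← q.target, hpq]
    obtain rfl : p = q := Path.ext (funext hpq)
    exact hp
  set c : Γ.V ⊕ Γ.E → Set I :=
    Sum.elim (fun v => {s | 0 < bump v (γ s)}) fun e => {s | wrap e (γ s) ≠ 1} with hc
  have hco : ∀ i, IsOpen (c i) := by
    rintro (v | e)
    · exact isOpen_lt continuous_const (by fun_prop)
    · exact isOpen_ne_fun (by fun_prop) continuous_const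
  have hcu : Set.univ ⊆ ⋃ i, c i := by
    intro s _
    rcases pt_or_vtx (γ s) with ⟨v, hv⟩ | ⟨e, t, ht, he⟩
    · refine Set.mem_iUnion.2 ⟨Sum.inl v, ?_⟩
      change 0 < bump v (γ s)
      rw [hv, bump_vtx_self]
      exact one_pos
    · refine Set.mem_iUnion.2 ⟨Sum.inr e, ?_⟩
      change wrap e (γ s) ≠ 1
      rw [he]
      exact wrap_pt_ne_one e ht
  obtain ⟨t, ht0, htm, ⟨N, hN⟩, htc⟩ := exists_monotone_Icc_subset_open_cover_unitInterval hco hcu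
  set δ := collapsePath γ with hδ
  have hmem : ∀ n s, Set.Icc.convexComb (t n) (t (n + 1)) s ∈ Set.Icc (t n) (t (n + 1)) :=
    fun n s => ⟨Set.Icc.le_convexComb (htm n.le_succ) s, Set.Icc.convexComb_le (htm n.le_succ) s⟩
  have hstep : ∀ n, P (Path.Homotopic.Quotient.mk (δ.subpath (t n) (t (n + 1)))) := by
    intro n
    obtain ⟨v | e, hi⟩ := htc n
    · exact hconst _ (vtx v) fun s => collapse_of_bump_pos (hi (hmem n s))
    · obtain ⟨θ, hθ⟩ := exists_continuous_parameter (e := e)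
        (u := γ.subpath (t n) (t (n + 1))) (Path.continuous _) fun s => hi (hmem n s)
      refine hpiece _ e ⟨fun s => stretch (θ s), continuous_stretch.comp θ.continuous⟩ fun s => ?_
      exact (congrArg (collapse Γ) (hθ s)).trans (collapse_pt e _)
  have hall : ∀ n, P (Path.Homotopic.Quotient.mk (δ.subpath (t 0) (t n))) := by
    intro n
    induction n with
    | zero => rw [Path.subpath_self]; exact hrefl _
    | succ n ih =>
      rw [← Path.Homotopic.Quotient.eq.2
        ⟨Path.Homotopy.subpathTransSubpath δ (t 0) (t n) (t (n + 1))⟩]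
      exact htrans _ _ ih (hstep n)
  have hfin := hall N
  rw [ht0, hN N le_rfl] at hfin
  rw [Path.Homotopic.Quotient.eq.2 (homotopic_collapsePath γ)]
  refine hcongr _ _ (fun s => ?_) hfin
  rw [Path.subpath_zero_one]
  rfl

end Multigraph

/-! ### The fundamental group of a graph that is a forest off finitely many edges -/

namespace Path.Homotopic.Quotient

variable {X : Type*} [TopologicalSpace X] {x y z u : X}

theorem symm_trans_trans (p : Path.Homotopic.Quotient x y) (q : Path.Homotopic.Quotient y z) :
    p.symm.trans (p.trans q) = q := by
  rw [← trans_assoc, symm_trans, refl_trans]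

theorem trans_symm_trans (p : Path.Homotopic.Quotient x y) (q : Path.Homotopic.Quotient x z) :
    p.trans (p.symm.trans q) = q := by
  rw [← trans_assoc, trans_symm, refl_trans]

theorem conj_trans_conj (k : Path.Homotopic.Quotient u x) (k' : Path.Homotopic.Quotient u y)
    (k'' : Path.Homotopic.Quotient u z) (a : Path.Homotopic.Quotient x y)
    (b : Path.Homotopic.Quotient y z) :
    ((k.trans a).trans k'.symm).trans ((k'.trans b).trans k''.symm) =
      (k.trans (a.trans b)).trans k''.symm := by
  simp only [trans_assoc, symm_trans_trans]

end Path.Homotopic.Quotient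

namespace Multigraph

variable {Γ : Multigraph}

/-- The linear path along the edge `e` from its initial vertex to the point with parameter `t`. -/
def segPath (e : Γ.E) (t : I) : Path (vtx (Γ.src e)) (pt e t) where
  toFun s := pt e (Set.Icc.convexComb 0 t s)
  continuous_toFun := (continuous_pt e).comp (Set.Icc.continuous_convexComb 0 t)
  source' := by rw [Set.Icc.convexComb_zero, pt_zero]
  target' := by rw [Set.Icc.convexComb_one]

/-- Paths in the unit interval with the same end points are homotopic. -/
theorem _root_.unitInterval.path_homotopic {s t : I} (p q : Path s t) : p.Homotopic q := by
  have : ContractibleSpace I := (convex_Icc (0 : ℝ) 1).contractibleSpace ⟨0, by simp⟩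
  exact SimplyConnectedSpace.paths_homotopic p q

theorem segPath_trans (e : Γ.E) {s t : I} (θ : Path s t) :
    (Path.Homotopic.Quotient.mk (segPath e s)).trans
      (Path.Homotopic.Quotient.mk (θ.map (continuous_pt e))) =
        Path.Homotopic.Quotient.mk (segPath e t) := by
  let lin : ∀ t : I, Path 0 t := fun t =>
    ⟨⟨Set.Icc.convexComb 0 t, Set.Icc.continuous_convexComb 0 t⟩, Set.Icc.convexComb_zero _ _,
      Set.Icc.convexComb_one _ _⟩
  have h₁ : ((segPath e s).trans (θ.map (continuous_pt e))) =
      (((lin s).trans θ).map (continuous_pt e)).cast (pt_zero e).symm rfl := by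
    ext r
    rw [Path.cast_coe, Path.map_coe, Function.comp_apply, Path.trans_apply, Path.trans_apply]
    split_ifs <;> rfl
  have h₂ : segPath e t = ((lin t).map (continuous_pt e)).cast (pt_zero e).symm rfl := rfl
  rw [← Path.Homotopic.Quotient.mk_trans, Path.Homotopic.Quotient.eq, h₁, h₂]
  exact ((unitInterval.path_homotopic ((lin s).trans θ) (lin t)).map
    ⟨_, continuous_pt e⟩).pathCast _ _

/-- Paths from the base vertex to all vertices such that the path to the terminal vertex of any edge
of a forest runs, up to homotopy, across that edge. -/
theorem IsForest.exists_compatible_paths [ConnectedSpace Γ.Realization] {A : Set Γ.E}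
    (hA : IsForest A) (v₀ : Γ.V) :
    ∃ κ : ∀ v, Path.Homotopic.Quotient (vtx v₀ : Γ.Realization) (vtx v), ∀ e ∈ A,
      (κ (Γ.src e)).trans (Path.Homotopic.Quotient.mk (edgePath e)) = κ (Γ.tgt e) := by
  let κ₀ : ∀ v, Path.Homotopic.Quotient (vtx v₀ : Γ.Realization) (vtx v) := fun v =>
    Path.Homotopic.Quotient.mk (joinedIn_carrier (conn_univ v₀ v)).somePath
  let loop : Γ.E → FundamentalGroup Γ.Realization (vtx v₀) := fun e =>
    FundamentalGroup.fromPath ((κ₀ (Γ.src e)).trans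
      ((Path.Homotopic.Quotient.mk (edgePath e)).trans (κ₀ (Γ.tgt e)).symm))
  -- the inverses account for the order of multiplication in the fundamental group
  obtain ⟨p, hp⟩ := hA.exists_potential fun e => (loop e)⁻¹
  let r : Γ.V → FundamentalGroup Γ.Realization (vtx v₀) := fun v => (p v)⁻¹
  refine ⟨fun v => (FundamentalGroup.toPath (r v)).trans (κ₀ v), fun e he => ?_⟩
  have h : r (Γ.tgt e) = FundamentalGroup.fromPath
      ((FundamentalGroup.toPath (r (Γ.src e))).trans (FundamentalGroup.toPath (loop e))) := by
    change (p (Γ.tgt e))⁻¹ = loop e * (p (Γ.src e))⁻¹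
    rw [← hp e he, mul_inv_rev, inv_inv]
  beta_reduce
  rw [h]
  simp only [loop, FundamentalGroup.fromPath, FundamentalGroup.fromArrow,
    Path.Homotopic.Quotient.trans_assoc, Path.Homotopic.Quotient.symm_trans,
    Path.Homotopic.Quotient.trans_refl]

/-- The fundamental group is generated by the loops across the edges of `F`, closed up along paths
that are compatible with the forest. -/
theorem fundamentalGroup_fg_of_isForest [ConnectedSpace Γ.Realization] {F : Set Γ.E}
    (hF : F.Finite) (hA : IsForest Fᶜ) (v₀ : Γ.V) :
    Group.FG (FundamentalGroup Γ.Realization (vtx v₀)) := by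
  obtain ⟨κ, hκ⟩ := hA.exists_compatible_paths v₀
  let gen : Γ.E → FundamentalGroup Γ.Realization (vtx v₀) := fun e =>
    FundamentalGroup.fromPath (((κ (Γ.src e)).trans
      (Path.Homotopic.Quotient.mk (edgePath e))).trans (κ (Γ.tgt e)).symm)
  set N : Subgroup (FundamentalGroup Γ.Realization (vtx v₀)) := Subgroup.closure (gen '' F) with hN
  have hgen : ∀ e, gen e ∈ N := by
    intro e
    by_cases he : e ∈ F
    · exact Subgroup.subset_closure ⟨e, he, rfl⟩
    · have : gen e = 1 := by
        simp only [gen]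
        rw [hκ e he, Path.Homotopic.Quotient.trans_symm]
        rfl
      rw [this]
      exact N.one_mem
  -- extend the paths `κ` to all points: an interior point of an edge is reached from the initial
  -- vertex
  have hpath : ∀ x : Γ.Realization, ∃ κx : Path.Homotopic.Quotient (vtx v₀ : Γ.Realization) x,
      ∀ (e : Γ.E) (t : I) (h : pt e t = x),
        FundamentalGroup.fromPath (((κ (Γ.src e)).trans
          ((Path.Homotopic.Quotient.mk (segPath e t)).cast rfl h.symm)).trans κx.symm) ∈ N := by
    intro x
    rcases pt_or_vtx x with ⟨v, rfl⟩ | ⟨e, t, ht, rfl⟩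
    · refine ⟨κ v, fun e t h => ?_⟩
      have ht : t = 0 ∨ t = 1 := by
        by_contra! ht
        exact wrap_pt_ne_one e ⟨unitInterval.pos_iff_ne_zero.2 ht.1,
          unitInterval.lt_one_iff_ne_one.2 ht.2⟩ (by rw [h, wrap_vtx])
      rcases ht with rfl | rfl
      · obtain rfl : Γ.src e = v := vtx_injective ((pt_zero e).symm.trans h)
        have hs : (segPath e 0).cast rfl h.symm = Path.refl _ := by
          ext s
          change pt e (Set.Icc.convexComb 0 0 s) = vtx (Γ.src e)
          rw [Set.Icc.convexComb_eq, pt_zero]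
        rw [← Path.Homotopic.Quotient.mk_cast, hs, Path.Homotopic.Quotient.mk_refl,
          Path.Homotopic.Quotient.trans_refl, Path.Homotopic.Quotient.trans_symm]
        exact N.one_mem
      · obtain rfl : Γ.tgt e = v := vtx_injective ((pt_one e).symm.trans h)
        have hs : (segPath e 1).cast rfl h.symm = edgePath e := by
          ext s
          change pt e (Set.Icc.convexComb 0 1 s) = pt e s
          rw [Set.Icc.convexComb_zero_one]
        rw [← Path.Homotopic.Quotient.mk_cast, hs]
        exact hgen e
    · refine ⟨(κ (Γ.src e)).trans (Path.Homotopic.Quotient.mk (segPath e t)), fun e' t' h => ?_⟩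
      obtain ⟨rfl, rfl⟩ := pt_eq_pt_interior ht h
      rw [Path.Homotopic.Quotient.cast_rfl_rfl, Path.Homotopic.Quotient.trans_symm]
      exact N.one_mem
  choose κ' hκ' using hpath
  -- closed up along the paths `κ'`, every path gives an element of `N`: it suffices to treat
  -- paths in closed edges
  have hmain : ∀ γ : Path (vtx v₀ : Γ.Realization) (vtx v₀),
      FundamentalGroup.fromPath (((κ' (vtx v₀)).trans (Path.Homotopic.Quotient.mk γ)).trans
        (κ' (vtx v₀)).symm) ∈ N := by
    refine fun γ => path_induction
      (P := fun {x y} a => FundamentalGroup.fromPath (((κ' x).trans a).trans (κ' y).symm) ∈ N)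
      (fun {x y z} a b ha hb => ?_) (fun x => ?_) (fun e s t θ => ?_) γ
    · have := N.mul_mem hb ha
      rw [FundamentalGroup.mul_def] at this
      exact Path.Homotopic.Quotient.conj_trans_conj (κ' x) (κ' y) (κ' z) a b ▸ this
    · rw [Path.Homotopic.Quotient.trans_refl, Path.Homotopic.Quotient.trans_symm]
      exact N.one_mem
    · have hs := hκ' _ e s rfl
      have ht := hκ' _ e t rfl
      rw [Path.Homotopic.Quotient.cast_rfl_rfl] at hs ht
      rw [← segPath_trans e θ, ← Path.Homotopic.Quotient.conj_trans_conj _ (κ' (pt e s))] at ht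
      exact (N.mul_mem_cancel_right hs).1 ht
  -- conjugation by `κ' (vtx v₀)` is surjective
  refine Group.fg_iff.2 ⟨gen '' F, ?_, hF.image _⟩
  refine (Subgroup.eq_top_iff' _).2 fun β => ?_
  obtain ⟨γ, hγ⟩ := Path.Homotopic.Quotient.mk_surjective
    (((κ' (vtx v₀)).symm.trans (FundamentalGroup.toPath β)).trans (κ' (vtx v₀)))
  have := hmain γ
  rw [hγ] at this
  simp only [Path.Homotopic.Quotient.trans_assoc, Path.Homotopic.Quotient.trans_symm_trans,
    Path.Homotopic.Quotient.trans_symm, Path.Homotopic.Quotient.trans_refl] at this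
  exact this

/-- Infinite rank in combinatorial terms: otherwise the graph would be a forest off a finite set of
edges. -/
theorem hasManyCycles_of_hasInfiniteRank {Γ : Multigraph}
    [ConnectedSpace Γ.Realization] (h : HasInfiniteRank Γ.Realization) : Γ.HasManyCycles := by
  by_contra hcon
  simp only [HasManyCycles, not_forall, not_exists, not_and] at hcon
  obtain ⟨F, hF, hA⟩ := hcon
  have hforest : IsForest Fᶜ := fun e he hc => hA e he (by rwa [Set.compl_union])
  obtain ⟨x⟩ : Nonempty Γ.Realization := inferInstance
  have hV : Nonempty Γ.V := by
    induction x using realization_ind with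
    | hv v => exact ⟨v⟩
    | he e t => exact ⟨Γ.src e⟩
  obtain ⟨v₀⟩ := hV
  exact h _ (fundamentalGroup_fg_of_isForest hF hforest v₀)

end Multigraph

/-! ### The Grigorchuk group -/

theorem Grigorchuk.length_a (w : List Bool) : (a w).length = w.length := by
  cases w <;> rfl

theorem Grigorchuk.length_bcd (i : Fin 3) (w : List Bool) : (bcd i w).length = w.length := by
  induction w generalizing i with
  | nil => rfl
  | cons x w ih =>
    cases x
    · by_cases h : i = 2 <;> simp [bcd, h, length_a]
    · simp [bcd, ih]

theorem length_of_mem_grigorchukGroup {g : Equiv.Perm (List Bool)} (hg : g ∈ grigorchukGroup)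
    (w : List Bool) : (g w).length = w.length := by
  induction hg using Subgroup.closure_induction generalizing w with
  | mem g hg =>
    rcases hg with rfl | rfl | rfl | rfl
    · exact Grigorchuk.length_a w
    all_goals exact Grigorchuk.length_bcd _ w
  | one => rfl
  | mul g h _ _ ihg ihh => exact (ihg _).trans (ihh w)
  | inv g _ ih => simpa using (ih (g⁻¹ w)).symm

end

theorem mainTheorem10 (Γ : Multigraph) (hfin : Γ.LocallyFinite)
    (hconn : ConnectedSpace Γ.Realization) (hrank : HasInfiniteRank Γ.Realization) :
    ∃ H : Subgroup (PureMappingClassGroup Γ.Realization), Nonempty (H ≃* grigorchukGroup) := by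
  obtain ⟨S⟩ := (Multigraph.hasManyCycles_of_hasInfiniteRank hrank).exists_handleSystem hfin
  have hW : ∀ n, {w : List Bool | w.length = n}.Finite := List.finite_length_eq Bool
  exact ⟨_, ⟨(MonoidHom.ofInjective (S.pureHom_injective hW grigorchukGroup
    fun g hg w => length_of_mem_grigorchukGroup hg w)).symm⟩⟩
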